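/- Write $\lg=\log_2$, $[m]=\{0,\dots,m-1\}$ and ${\cal B}(n,m)=\lceil \lg\binom{m}{n}\rceil$. For an $n$-element set $S\subseteq[m]$ let $\mathrm{Rank}(x,S)$, for $x\in[m]$, be $|\{y\in S: y<x\}|$ if $x\in S$ and $-1$ otherwise, and let $\mathrm{Select}(i,S)$, for $i\in\{1,\dots,n\}$, be the $i$-th smallest element of $S$. In the cell probe model with word size $w$, a string of $L$ bits is stored in consecutive cells of $w$ bits each (the last one padded with zeros); a query algorithm knows $n$, $m$, $w$, $L$ and the query, reads cells adaptively, and is charged only for the number of cells it reads. An indexable dictionary for the $n$-element subsets of $[m]$ using $L$ bits and $t$ probes assigns to each such $S$ a string of $L$ bits from which every $\mathrm{Rank}(x,S)$ and every $\mathrm{Select}(i,S)$ query is answered correctly with at most $t$ probes. Let the word size be any function $w=w(m)=\Theta(\lg m)$ with $w(m)\ge 1$ for $m\ge 2$. 1. There are a constant $t$ and a function $e(n)=o(n)$ of $n$ alone such that for all $0\le n\le m$ there is an indexable dictionary for the $n$-element subsets of $[m]$ that uses at most ${\cal B}(n,m)+e(n)$ bits and $t$ probes per query in the cell probe model with word size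 $w(m)$. 2. There is a constant $t$ such that for all $0\le n\le m$ there is an indexable dictionary for the $n$-element subsets of $[m]$ that uses at most $n\lceil\lg m\rceil$ bits and $t$ probes per query in the cell probe model with word size $w(m)$. In particular, for word size exactly $\lceil\lg m\rceil$, $n$ words suffice (with $\lceil \lg 0\rceil$ read as $0$). -/

import Mathlib

/-- `lowerBoundBits n m = ⌈lg (m choose n)⌉`, written `B(n,m)`: the least number of bits that suffices
to encode every `n`-element subset of `{0, …, m-1}`. (`Nat.clog 2 x = ⌈lg x⌉` for `x ≥ 1`.) -/
def lowerBoundBits (n m : ℕ) : ℕ := Nat.clog 2 (m.choose n)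

/-- `Rank(x, S)`: the number of elements of `S` smaller than `x` if `x ∈ S`, and `-1` otherwise. -/
def rankQuery {m : ℕ} (S : Finset (Fin m)) (x : Fin m) : ℤ :=
  if x ∈ S then ((S.filter (fun y => y < x)).card : ℤ) else -1

/-- A deterministic query algorithm of the cell probe model with `w`-bit cells and answers in `α`.
It either stops with an answer, or reads the cell at some address and continues in an arbitrary
way that depends on the content read. Only probes are charged for. -/
inductive CellProbeAlg (w : ℕ) (α : Type) : Type
  | answer (a : α) : CellProbeAlg w α
  | probe (addr : ℕ) (next : (Fin w → Bool) → CellProbeAlg w α) : CellProbeAlg w α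

namespace CellProbeAlg

/-- The answer of the algorithm when the memory cells have the contents `mem`. -/
def eval {w : ℕ} {α : Type} (mem : ℕ → Fin w → Bool) : CellProbeAlg w α → α
  | answer a => a
  | probe addr next => eval mem (next (mem addr))

/-- The number of cells that the algorithm reads when the memory cells have the contents `mem`. -/
def probes {w : ℕ} {α : Type} (mem : ℕ → Fin w → Bool) : CellProbeAlg w α → ℕ
  | answer _ => 0
  | probe addr next => probes mem (next (mem addr)) + 1

end CellProbeAlg

/-- A string of `L` bits laid out in consecutive cells of `w` bits: cell `i` holds the bits
`i * w, …, i * w + w - 1`. Positions beyond the end of the string read as `false`. -/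
def cellsOf (w : ℕ) {L : ℕ} (bits : Fin L → Bool) : ℕ → Fin w → Bool :=
  fun i j => if h : i * w + j < L then bits ⟨i * w + j, h⟩ else false

/-- There is an indexable dictionary for the `n`-element subsets `S` of `{0, …, m-1}` that occupies
`L` bits, in the cell probe model with word size `w`, and answers each query with at most `t`
probes. The query algorithms may depend on `n`, `m`, `w`, `L` and the query, and access `S` only by
probing its encoding. `Rank` is asked at `x ∈ {0, …, m-1}`; `Select` is asked at
`i ∈ {1, …, n}`, here `i = k + 1` with `k : Fin n`, and returns the `i`-th smallest element. -/
def HasIndexableDictionary (n m w L t : ℕ) : Prop :=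
  ∃ (encode : Finset (Fin m) → Fin L → Bool)
    (rankAlg : Fin m → CellProbeAlg w ℤ) (selectAlg : ℕ → CellProbeAlg w ℕ),
    ∀ (S : Finset (Fin m)) (hS : S.card = n),
      (∀ x : Fin m,
        (rankAlg x).eval (cellsOf w (encode S)) = rankQuery S x ∧
        (rankAlg x).probes (cellsOf w (encode S)) ≤ t) ∧
      (∀ k : Fin n,
        (selectAlg (k + 1)).eval (cellsOf w (encode S)) = (S.orderEmbOfFin hS k : ℕ) ∧
        (selectAlg (k + 1)).probes (cellsOf w (encode S)) ≤ t)

/-- `w` is a word size (as a function of the universe size `m`) that is `Θ(lg m)`, and positive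
as soon as the universe has at least two elements. -/
def IsLogWordSize (w : ℕ → ℕ) : Prop :=
  (∀ m, 2 ≤ m → 0 < w m) ∧
  Asymptotics.IsTheta Filter.atTop (fun m : ℕ => (w m : ℝ)) (fun m : ℕ => Real.logb 2 (m : ℝ))

/-! A read of `W = 4⌈lg m⌉` consecutive bits at any bit address costs a constant number of cells.
Moreover, queries need only be correct for members: a candidate rank of `x` is verified by selecting
the element of that rank and comparing it with `x`, which decides membership. So the object to
construct is `HasDict`. Its query algorithms may contain any tables, such as families of hash
functions, that depend on the sizes only.

Write `lam = ⌈lg m⌉` and `L = ⌈lg lam⌉`, with `L` large. There are two base structures. For at most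
`2 ^ (L / 8)` members, a single word determines the ranks and the leading bits of the members, and
the trailing bits are listed separately; this wastes 3 bits (`HasDict.small`). For larger sets, a
sorted list and a two-level perfect hash table for the ranks waste `O(k lg k)` bits
(`HasDict.of_hashing`).

The engine is `HasSuccinctDict.blocks`. It cuts the universe into at most `3n / v ^ 5` blocks and
adds a directory of `O(n / v)` bits. The binomial coefficients of ordinary blocks multiply up to at
most that of the whole set. A block with `k` members, far above its average share, has so few
possible contents that it saves `k lg k / 2` bits (`sum_logb_choose_add_le`). This saving pays for
part of the block's redundancy, so each level lowers the coefficient of `k lg k` by 1/2. The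
coefficient is constant, so 444 levels remove the term.

Directory entries of `v` bits must hold all addresses, while blocks of size polynomial in `v` must
already be solved. Hence there are two rounds: `v = 16 * L` for at most `2 ^ (11 * L)` members, then
`v = 3 * lam`, with the first round used inside the small blocks. The result wastes `O(n / L) + 3`
bits, and `L ≥ lg lg n` bounds this by a function `o(n)` of `n` alone.

For the second claim, `lg (m choose n) ≤ n (lg m - lg n + 2)`, so for large `n` the gain `n lg n`
exceeds the redundancy. For bounded `n` the index of the set occupies a constant number of words. -/

/-! ### Bit memories and adaptive reads of bit windows. -/

/-- A memory, as an infinite sequence of bits. -/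
abbrev BitMem := ℕ → Bool

/-- The memory as seen from address `a` on. -/
def BitMem.shift (a : ℕ) (mem : BitMem) : BitMem := fun i => mem (a + i)

/-- The number whose `v` binary digits are stored at the addresses `a, …, a + v - 1`. -/
def BitMem.readNat (mem : BitMem) (a v : ℕ) : ℕ := Nat.ofBits (fun i : Fin v => mem (a + i))

/-- `f` can be evaluated by `t` adaptive reads of `W` consecutive bits each. -/
def Probing (W : ℕ) {α : Type} : ℕ → (BitMem → α) → Prop
  | 0, f => ∃ a, ∀ mem, f mem = a
  | t + 1, f => ∃ (addr : ℕ) (g : (Fin W → Bool) → BitMem → α),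
      (∀ v, Probing W t (g v)) ∧ ∀ mem, f mem = g (fun i => mem (addr + i)) mem

namespace Probing

variable {W s t : ℕ} {α β : Type}

theorem const (a : α) : Probing W t (fun _ => a) := by
  induction t with
  | zero => exact ⟨a, fun _ => rfl⟩
  | succ t ih => exact ⟨0, fun _ _ => a, fun _ => ih, fun _ => rfl⟩

theorem succ {f : BitMem → α} (h : Probing W t f) : Probing W (t + 1) f :=
  ⟨0, fun _ => f, fun _ => h, fun _ => rfl⟩

theorem mono {f : BitMem → α} (h : Probing W s f) (hst : s ≤ t) : Probing W t f := by
  induction t, hst using Nat.le_induction with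
  | base => exact h
  | succ t _ ih => exact ih.succ

/-- This is adaptivity: the addresses read by the second computation may depend on the outcome of
the first, and the costs add up. -/
theorem bind {f : BitMem → α} {g : α → BitMem → β} (hf : Probing W s f)
    (hg : ∀ a, Probing W t (g a)) : Probing W (s + t) (fun mem => g (f mem) mem) := by
  induction s generalizing f with
  | zero =>
    obtain ⟨a, ha⟩ := hf
    simp only [ha, Nat.zero_add]
    exact hg a
  | succ s ih =>
    obtain ⟨addr, k, hk, hfk⟩ := hf
    rw [Nat.add_right_comm]
    exact ⟨addr, fun v mem => g (k v mem) mem, fun v => ih (hk v), fun mem => by simp only [hfk]⟩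

theorem map {f : BitMem → α} (g : α → β) (hf : Probing W t f) :
    Probing W t (fun mem => g (f mem)) :=
  hf.bind (t := 0) (g := fun a _ => g a) fun a => const (g a)

theorem shift {f : BitMem → α} (hf : Probing W t f) (a : ℕ) :
    Probing W t (fun mem => f (mem.shift a)) := by
  induction t generalizing f with
  | zero =>
    obtain ⟨b, hb⟩ := hf
    exact ⟨b, fun _ => hb _⟩
  | succ t ih =>
    obtain ⟨addr, k, hk, hfk⟩ := hf
    refine ⟨a + addr, fun v mem => k v (mem.shift a), fun v => ih (hk v), fun mem => ?_⟩
    simp only [hfk, BitMem.shift, Nat.add_assoc]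

theorem readNat {v : ℕ} (hv : v ≤ W) (a : ℕ) :
    Probing W 1 (fun mem : BitMem => mem.readNat a v) :=
  ⟨a, fun b _ => Nat.ofBits (fun i : Fin v => b (Fin.castLE hv i)),
    fun _ => const _, fun _ => rfl⟩

end Probing

namespace BitMem

theorem readNat_testBit {mem : BitMem} {a v x : ℕ} (hx : x < 2 ^ v)
    (h : ∀ i < v, mem (a + i) = x.testBit i) : mem.readNat a v = x := by
  unfold readNat
  have : (fun i : Fin v => mem (a + i)) = fun i : Fin v => x.testBit i := funext fun i => h i i.2
  rw [this, Nat.ofBits_testBit, Nat.mod_eq_of_lt hx]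

/-- The memory that stores the numbers `a 0, a 1, …` in consecutive fields of `v` bits. -/
def array (v : ℕ) (a : ℕ → ℕ) : BitMem := fun p => (a (p / v)).testBit (p % v)

theorem readNat_array {mem : BitMem} {b v N i : ℕ} {a : ℕ → ℕ}
    (h : ∀ p < N * v, mem (b + p) = array v a p) (hi : i < N) (ha : a i < 2 ^ v) :
    mem.readNat (b + i * v) v = a i := by
  refine readNat_testBit ha fun j hj => ?_
  have h1 : i * v + j < N * v := by
    calc i * v + j < i * v + v := by omega
      _ = (i + 1) * v := by ring
      _ ≤ N * v := Nat.mul_le_mul_right _ hi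
  rw [Nat.add_assoc, h _ h1, array]
  have hv : 0 < v := by omega
  rw [Nat.mul_comm i v, Nat.mul_add_div hv, Nat.div_eq_of_lt hj, Nat.mul_add_mod,
    Nat.mod_eq_of_lt hj, Nat.add_zero]

/-- The first `ℓ` bits of `e`, followed by `e'`. -/
def append (ℓ : ℕ) (e e' : BitMem) : BitMem := fun p => if p < ℓ then e p else e' (p - ℓ)

theorem append_left {ℓ p : ℕ} (e e' : BitMem) (h : p < ℓ) : append ℓ e e' p = e p := if_pos h

theorem append_right (ℓ p : ℕ) (e e' : BitMem) : append ℓ e e' (ℓ + p) = e' p := by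
  simp [append]

theorem exists_concat (len : ℕ → ℕ) (e : ℕ → BitMem) (N : ℕ) :
    ∃ c : BitMem, ∀ i < N, ∀ j < len i, c (∑ i' ∈ Finset.range i, len i' + j) = e i j := by
  induction N with
  | zero => exact ⟨fun _ => false, by simp⟩
  | succ N ih =>
    obtain ⟨c, hc⟩ := ih
    refine ⟨append (∑ i' ∈ Finset.range N, len i') c (e N), fun i hi j hj => ?_⟩
    rcases Nat.lt_succ_iff_lt_or_eq.1 hi with h | rfl
    · rw [append_left, hc i h j hj]
      calc _ < ∑ i' ∈ Finset.range (i + 1), len i' := by rw [Finset.sum_range_succ]; omega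
        _ ≤ _ := Finset.sum_le_sum_of_subset (Finset.range_subset_range.2 h)
    · rw [append_right]

end BitMem

/-! ### Rank and selection in finite sets of natural numbers. -/

/-- The number of elements of `S` below `x`. -/
def finsetRank (S : Finset ℕ) (x : ℕ) : ℕ := (S.filter (· < x)).card

theorem finsetRank_lt_finsetRank {S : Finset ℕ} {x y : ℕ} (hx : x ∈ S) (h : x < y) :
    finsetRank S x < finsetRank S y :=
  Finset.card_lt_card (Finset.ssubset_iff_of_subset (fun z hz => by
    simp only [Finset.mem_filter] at hz ⊢
    exact ⟨hz.1, hz.2.trans h⟩) |>.2 ⟨x, by simp [hx, h], by simp⟩)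

theorem finsetRank_lt_card {S : Finset ℕ} {x : ℕ} (hx : x ∈ S) : finsetRank S x < S.card :=
  Finset.card_lt_card (Finset.filter_ssubset.2 ⟨x, hx, lt_irrefl x⟩)

theorem finsetRank_le_card (S : Finset ℕ) (x : ℕ) : finsetRank S x ≤ S.card :=
  Finset.card_filter_le _ _

theorem finsetRank_injOn (S : Finset ℕ) : Set.InjOn (finsetRank S) S := fun x hx y hy h => by
  rcases lt_trichotomy x y with h' | h' | h'
  · exact absurd h (finsetRank_lt_finsetRank hx h').ne
  · exact h'
  · exact absurd h (finsetRank_lt_finsetRank hy h').ne'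

theorem exists_finsetRank_eq {S : Finset ℕ} {i : ℕ} (hi : i < S.card) :
    ∃ x ∈ S, finsetRank S x = i := by
  have : S.image (finsetRank S) = Finset.range S.card := by
    refine Finset.eq_of_subset_of_card_le (fun i hi => ?_) ?_
    · obtain ⟨x, hx, rfl⟩ := Finset.mem_image.1 hi
      exact Finset.mem_range.2 (finsetRank_lt_card hx)
    · rw [Finset.card_range, Finset.card_image_of_injOn (finsetRank_injOn S)]
  exact Finset.mem_image.1 (this ▸ Finset.mem_range.2 hi)

open Classical in
/-- The element of rank `i` in `S` (and `0` if there is none). -/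
noncomputable def finsetNth (S : Finset ℕ) (i : ℕ) : ℕ :=
  if h : ∃ x ∈ S, finsetRank S x = i then h.choose else 0

theorem finsetNth_finsetRank {S : Finset ℕ} {x : ℕ} (hx : x ∈ S) :
    finsetNth S (finsetRank S x) = x := by
  have h : ∃ y ∈ S, finsetRank S y = finsetRank S x := ⟨x, hx, rfl⟩
  rw [finsetNth, dif_pos h]
  exact finsetRank_injOn S h.choose_spec.1 hx h.choose_spec.2

theorem finsetNth_mem {S : Finset ℕ} {i : ℕ} (hi : i < S.card) : finsetNth S i ∈ S := by
  obtain ⟨x, hx, rfl⟩ := exists_finsetRank_eq hi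
  rwa [finsetNth_finsetRank hx]

theorem finsetRank_finsetNth {S : Finset ℕ} {i : ℕ} (hi : i < S.card) :
    finsetRank S (finsetNth S i) = i := by
  obtain ⟨x, hx, rfl⟩ := exists_finsetRank_eq hi
  rw [finsetNth_finsetRank hx]

theorem finsetNth_mono {S : Finset ℕ} {i j : ℕ} (hj : j < S.card) (h : i ≤ j) :
    finsetNth S i ≤ finsetNth S j := by
  by_contra! hlt
  have := finsetRank_lt_finsetRank (finsetNth_mem hj) hlt
  rw [finsetRank_finsetNth hj, finsetRank_finsetNth (h.trans_lt hj)] at this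
  omega

/-! ### Dictionaries for members, and codes of one word. -/

/-- There is a data structure of `ℓ` bits for the `k`-element subsets of `{0, …, U - 1}` that finds,
by `t` reads of `W` consecutive bits, the rank of a given member and the member of a given rank. -/
def HasDict (W t U k ℓ : ℕ) : Prop :=
  ∃ rank select : ℕ → BitMem → ℕ,
    (∀ x, Probing W t (rank x)) ∧ (∀ i, Probing W t (select i)) ∧
    ∀ S ⊆ Finset.range U, S.card = k → ∃ e : BitMem, ∀ mem : BitMem, (∀ i < ℓ, mem i = e i) →
      ∀ x ∈ S, rank x mem = finsetRank S x ∧ select (finsetRank S x) mem = x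

theorem HasDict.mono {W s t U k ℓ ℓ' : ℕ} (h : HasDict W s U k ℓ) (hst : s ≤ t) (hℓ : ℓ ≤ ℓ') :
    HasDict W t U k ℓ' := by
  obtain ⟨rank, select, h1, h2, h3⟩ := h
  refine ⟨rank, select, fun x => (h1 x).mono hst, fun i => (h2 i).mono hst, fun S hS hk => ?_⟩
  obtain ⟨e, he⟩ := h3 S hS hk
  exact ⟨e, fun mem hm => he mem fun i hi => hm i (hi.trans_le hℓ)⟩

/-- The data structure that consists of one code word, which determines the ranks of the members
and their leading parts, and of the list of the `ρ` trailing bits of the members. -/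
theorem HasDict.of_code {Γ : Type} [Fintype Γ] {W U k ρ : ℕ} (rank hi : Γ → ℕ → ℕ)
    (hW : Nat.clog 2 (Fintype.card Γ) ≤ W) (hρ : ρ ≤ W)
    (h : ∀ S ⊆ Finset.range U, S.card = k →
      ∃ c : Γ, ∀ x ∈ S, rank c x = finsetRank S x ∧ hi c (finsetRank S x) = x / 2 ^ ρ) :
    HasDict W 2 U k (Nat.clog 2 (Fintype.card Γ) + k * ρ) := by
  classical
  rcases isEmpty_or_nonempty Γ with hΓ | hΓ
  · refine ⟨fun _ _ => 0, fun _ _ => 0, fun _ => .const _, fun _ => .const _, fun S hS hk => ?_⟩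
    exact hΓ.elim (h S hS hk).choose
  set q := Nat.clog 2 (Fintype.card Γ)
  let ι := Fintype.equivFin Γ
  let dec : ℕ → Γ := Function.invFun (fun c : Γ => (ι c : ℕ))
  have hdec : ∀ c, dec (ι c) = c := Function.leftInverse_invFun
    (fun c c' hcc => ι.injective (Fin.ext hcc))
  refine ⟨fun x mem => rank (dec (mem.readNat 0 q)) x,
    fun i mem => hi (dec (mem.readNat 0 q)) i * 2 ^ ρ + mem.readNat (q + i * ρ) ρ,
    fun x => ((Probing.readNat hW 0).map fun c => rank (dec c) x).mono one_le_two, fun i => ?_, fun S hS hk => ?_⟩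
  · exact (Probing.readNat hW 0).bind (g := fun a mem => hi (dec a) i * 2 ^ ρ +
      mem.readNat (q + i * ρ) ρ) fun a => (Probing.readNat hρ _).map _
  · obtain ⟨c, hc⟩ := h S hS hk
    refine ⟨.append q (.array q fun _ => ι c) (.array ρ fun i => finsetNth S i % 2 ^ ρ),
      fun mem hmem x hx => ?_⟩
    have h1 : mem.readNat 0 q = ι c := by
      have := BitMem.readNat_array (mem := mem) (b := 0) (v := q) (N := 1) (i := 0)
        (a := fun _ => (ι c : ℕ)) (fun p hp => by
          rw [Nat.zero_add, hmem p (by omega), BitMem.append_left _ _ (by omega)]) one_pos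
        ((ι c).2.trans_le (Nat.le_pow_clog one_lt_two _))
      simpa using this
    have h2 : mem.readNat (q + finsetRank S x * ρ) ρ = x % 2 ^ ρ := by
      rw [BitMem.readNat_array (a := fun i => finsetNth S i % 2 ^ ρ) (N := k) (fun p hp => by
        rw [hmem _ (by omega), BitMem.append_right]) (hk ▸ finsetRank_lt_card hx)
        (Nat.mod_lt _ (by positivity)), finsetNth_finsetRank hx]
    simp only [h1, h2, hdec]
    refine ⟨(hc x hx).1, ?_⟩
    rw [(hc x hx).2, Nat.div_add_mod']

/-- The data structure that consists of the index of the set among all sets of its size. -/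
theorem HasDict.of_index {W U k : ℕ} (hW : Nat.clog 2 (U.choose k) ≤ W) :
    HasDict W 2 U k (Nat.clog 2 (U.choose k)) := by
  have hcard : Fintype.card {S // S ∈ Finset.powersetCard k (Finset.range U)} = U.choose k := by
    simp
  have := HasDict.of_code (Γ := {S // S ∈ Finset.powersetCard k (Finset.range U)}) (W := W)
    (U := U) (k := k) (ρ := 0) (fun S => finsetRank S) (fun S => finsetNth S) (by rwa [hcard])
    (Nat.zero_le _) (fun S hS hk => ⟨⟨S, Finset.mem_powersetCard.2 ⟨hS, hk⟩⟩, fun x hx => by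
      simp [finsetNth_finsetRank hx]⟩)
  rwa [hcard, Nat.mul_zero, Nat.add_zero] at this

/-! ### Small sets: distinct leading parts, or tests on single bits. -/

/-- Factor by factor, `V * (k - i) ≤ k * (V - i)`. It bounds both the share of non-injective tuples
and the cost of a sorted list. -/
theorem pow_le_pow_mul_choose {V k : ℕ} (h : k ≤ V) : V ^ k ≤ k ^ k * V.choose k := by
  have h1 : V ^ k * k.factorial ≤ k ^ k * V.descFactorial k := by
    rw [← Nat.descFactorial_self, Nat.descFactorial_eq_prod_range, Nat.descFactorial_eq_prod_range,
      ← Finset.card_range k, ← Finset.prod_const, ← Finset.prod_const, Finset.card_range,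
      ← Finset.prod_mul_distrib, ← Finset.prod_mul_distrib]
    refine Finset.prod_le_prod' fun i hi => ?_
    rw [Nat.mul_sub, Nat.mul_sub, Nat.mul_comm V k]
    exact Nat.sub_le_sub_left (Nat.mul_le_mul_right _ h) _
  rw [Nat.descFactorial_eq_factorial_mul_choose, Nat.mul_left_comm, Nat.mul_comm] at h1
  exact Nat.le_of_mul_le_mul_left h1 (Nat.factorial_pos k)

/-- Listing the trailing bits of every member separately costs a factor `c ^ k`; this absorbs it
into the binomial coefficient of the larger universe. -/
theorem choose_mul_pow_le (a c k : ℕ) (hc : 0 < c) : a.choose k * c ^ k ≤ (a * c).choose k := by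
  have h1 : a.descFactorial k * c ^ k ≤ (a * c).descFactorial k := by
    rw [Nat.descFactorial_eq_prod_range, Nat.descFactorial_eq_prod_range,
      ← Finset.card_range k, ← Finset.prod_const, Finset.card_range, ← Finset.prod_mul_distrib]
    refine Finset.prod_le_prod' fun i hi => ?_
    rw [Nat.sub_mul]
    exact Nat.sub_le_sub_left (Nat.le_mul_of_pos_right _ hc) _
  rw [Nat.descFactorial_eq_factorial_mul_choose, Nat.descFactorial_eq_factorial_mul_choose,
    Nat.mul_assoc] at h1
  exact Nat.le_of_mul_le_mul_left h1 (Nat.factorial_pos k)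

theorem choose_succ_le_two_mul {V k : ℕ} (h : 2 * k ≤ V + 1) :
    (V + 1).choose k ≤ 2 * V.choose k := by
  have h1 := Nat.choose_mul_succ_eq V k
  have h2 : (V + 1).choose k * (V + 1) ≤ 2 * V.choose k * (V + 1) := by
    calc (V + 1).choose k * (V + 1) ≤ (V + 1).choose k * (2 * (V + 1 - k)) :=
          Nat.mul_le_mul_left _ (by omega)
      _ = 2 * ((V + 1).choose k * (V + 1 - k)) := by ring
      _ = 2 * V.choose k * (V + 1) := by rw [← h1]; ring
  exact Nat.le_of_mul_le_mul_right h2 (Nat.succ_pos V)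

/-- Two given points collide under one in `N` of the functions to an `N`-element set. -/
theorem card_filter_apply_eq {α : Type} [Fintype α] [DecidableEq α] {x y : α} (hxy : x ≠ y)
    (N : ℕ) : (Finset.univ.filter fun h : α → Fin N => h x = h y).card * N
      = N ^ Fintype.card α := by
  -- Overwriting the value at `y` by the value at `x` forces the collision; the overwritten value is
  -- kept as the second component.
  have : Fintype.card ({h : α → Fin N // h x = h y} × Fin N) = Fintype.card (α → Fin N) := by
    refine Fintype.card_congr ⟨fun p => Function.update p.1.1 y p.2,
      fun g => (⟨Function.update g y (g x), by simp [Function.update_of_ne hxy]⟩, g y),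
      fun p => ?_, fun g => by simp⟩
    obtain ⟨⟨h, hh⟩, c⟩ := p
    simp [Function.update_of_ne hxy, hh]
  simpa [Fintype.card_subtype] using this

/-- A union bound over the pairs of positions that may coincide. -/
theorem card_not_injective_mul_le (k V : ℕ) :
    Fintype.card {f : Fin k → Fin V // ¬ Function.Injective f} * V ≤ k ^ 2 * V ^ k := by
  classical
  have hsub : (Finset.univ.filter fun f : Fin k → Fin V => ¬ Function.Injective f) ⊆
      (Finset.univ.filter fun p : Fin k × Fin k => p.1 ≠ p.2).biUnion
        fun p => Finset.univ.filter fun f : Fin k → Fin V => f p.1 = f p.2 := fun f hf => by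
    simp only [Finset.mem_filter, Finset.mem_univ, true_and, Function.Injective, not_forall] at hf
    obtain ⟨a, b, h1, h2⟩ := hf
    simp only [Finset.mem_biUnion, Finset.mem_filter, Finset.mem_univ, true_and]
    exact ⟨(a, b), h2, h1⟩
  rw [Fintype.card_subtype]
  calc _ ≤ (∑ p ∈ Finset.univ.filter fun p : Fin k × Fin k => p.1 ≠ p.2,
        (Finset.univ.filter fun f : Fin k → Fin V => f p.1 = f p.2).card) * V :=
        Nat.mul_le_mul_right _ ((Finset.card_le_card hsub).trans Finset.card_biUnion_le)
    _ = ∑ p ∈ Finset.univ.filter fun p : Fin k × Fin k => p.1 ≠ p.2, V ^ k := by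
        rw [Finset.sum_mul]
        refine Finset.sum_congr rfl fun p hp => ?_
        rw [card_filter_apply_eq (Finset.mem_filter.1 hp).2, Fintype.card_fin]
    _ ≤ k ^ 2 * V ^ k := by
        rw [Finset.sum_const, smul_eq_mul]
        refine Nat.mul_le_mul_right _ ((Finset.card_filter_le _ _).trans ?_)
        simp [sq]

theorem exists_testBit_ne {x y lam : ℕ} (hx : x < 2 ^ lam) (hy : y < 2 ^ lam) (h : x ≠ y) :
    ∃ p : Fin lam, x.testBit p ≠ y.testBit p := by
  by_contra! hp
  refine h (Nat.eq_of_testBit_eq fun i => ?_)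
  rcases lt_or_ge i lam with hi | hi
  · exact hp ⟨i, hi⟩
  · have := Nat.pow_le_pow_right two_pos hi
    rw [Nat.testBit_lt_two_pow (hx.trans_le this), Nat.testBit_lt_two_pow (hy.trans_le this)]

/-- Truncation is monotone, and strictly monotone on a set where it is injective. -/
theorem finsetRank_image_div {S : Finset ℕ} {c : ℕ}
    (hinj : Set.InjOn (· / c) (S : Set ℕ)) {x : ℕ} (hx : x ∈ S) :
    finsetRank (S.image (· / c)) (x / c) = finsetRank S x := by
  have : (S.image (· / c)).filter (· < x / c) = (S.filter (· < x)).image (· / c) := by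
    ext z
    simp only [Finset.mem_filter, Finset.mem_image]
    constructor
    · rintro ⟨⟨y, hy, rfl⟩, hlt⟩
      exact ⟨y, ⟨hy, Nat.lt_of_div_lt_div hlt⟩, rfl⟩
    · rintro ⟨y, ⟨hy, hlt⟩, rfl⟩
      refine ⟨⟨y, hy, rfl⟩, lt_of_le_of_ne (Nat.div_le_div_right hlt.le) fun h => ?_⟩
      exact hlt.ne (hinj hy hx h)
  unfold finsetRank
  rw [this, Finset.card_image_of_injOn]
  exact hinj.mono fun y hy => (Finset.mem_filter.1 hy).1

open Classical in
/-- The index `i` such that all tests `D (i, j)`, on a bit of `x` each, succeed. -/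
noncomputable def indexOfTests {k lam : ℕ} (D : Fin k × Fin k → Fin lam × Bool) (x : ℕ) : ℕ :=
  if h : ∃ i, ∀ j ≠ i, x.testBit (D (i, j)).1 = (D (i, j)).2 then h.choose else 0

/-- The test for `(i, j)` asks for a bit at which the members of ranks `i` and `j` differ, with its
value at the former. The member of rank `i` passes all its own tests, and fails the test for `(i',
i)` whenever `i' ≠ i`. There are only `(2 * lam) ^ k ^ 2` families of tests. -/
theorem exists_tests {S : Finset ℕ} {k lam : ℕ} (hS : ∀ x ∈ S, x < 2 ^ lam) (hk : S.card = k)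
    (hlam : 0 < lam) :
    ∃ D : Fin k × Fin k → Fin lam × Bool, ∀ x ∈ S, indexOfTests D x = finsetRank S x := by
  classical
  have hex : ∀ p : Fin k × Fin k, ∃ q : Fin lam, p.1 ≠ p.2 →
      (finsetNth S p.1).testBit q ≠ (finsetNth S p.2).testBit q := fun p => by
    by_cases h : p.1 = p.2
    · exact ⟨⟨0, hlam⟩, fun h' => absurd h h'⟩
    · have h1 := p.1.2.trans_eq hk.symm
      have h2 := p.2.2.trans_eq hk.symm
      obtain ⟨q, hq⟩ := exists_testBit_ne (hS _ (finsetNth_mem h1)) (hS _ (finsetNth_mem h2))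
        (fun h3 => h (Fin.ext (by
          rw [← finsetRank_finsetNth h1, h3, finsetRank_finsetNth h2])))
      exact ⟨q, fun _ => hq⟩
  choose pos hpos using hex
  refine ⟨fun p => (pos p, (finsetNth S p.1).testBit (pos p)), fun x hx => ?_⟩
  have hlt : finsetRank S x < k := hk ▸ finsetRank_lt_card hx
  have h : ∃ i : Fin k, ∀ j ≠ i, x.testBit (pos (i, j)) =
      (finsetNth S i).testBit (pos (i, j)) :=
    ⟨⟨_, hlt⟩, fun j _ => by simp only [finsetNth_finsetRank hx]⟩
  rw [indexOfTests, dif_pos h]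
  by_contra hne
  have h1 := h.choose_spec ⟨_, hlt⟩ (fun h2 => hne (by rw [← h2]))
  have h2 := hpos (h.choose, ⟨_, hlt⟩) (fun h2 => hne (by simp only at h2; rw [h2]))
  simp only [finsetNth_finsetRank hx] at h2
  exact h2 h1.symm

/-- Distinct leading parts already determine the ranks, so their set is a sufficient code. Otherwise
the code holds the tuple of leading parts and a family of tests; such tuples are rare enough to
afford the tests. -/
theorem HasDict.of_leading_parts {W U k lam ρ : ℕ} (hU : U ≤ 2 ^ lam) (hlam : 0 < lam)
    (hρ : ρ ≤ W) {N : ℕ} (hN : (U / 2 ^ ρ + 1).choose k +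
      Fintype.card {f : Fin k → Fin (U / 2 ^ ρ + 1) // ¬ Function.Injective f} *
        (2 * lam) ^ k ^ 2 ≤ N) (hW : Nat.clog 2 N ≤ W) :
    HasDict W 2 U k (Nat.clog 2 N + k * ρ) := by
  classical
  set V := U / 2 ^ ρ + 1 with hV
  let Γ := {H // H ∈ Finset.powersetCard k (Finset.range V)} ⊕
    {f : Fin k → Fin V // ¬ Function.Injective f} × (Fin k × Fin k → Fin lam × Bool)
  have hcard : Fintype.card Γ ≤ N := by
    refine le_trans (le_of_eq ?_) hN
    simp only [Γ, Fintype.card_sum, Fintype.card_prod, Fintype.card_coe, Finset.card_powersetCard,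
      Finset.card_range, Fintype.card_fun, Fintype.card_fin, Fintype.card_bool]
    rw [Nat.mul_comm lam 2, sq]
  have hclog := Nat.clog_mono_right 2 hcard
  refine (HasDict.of_code (Γ := Γ) (W := W) (U := U) (k := k) (ρ := ρ)
    (Sum.elim (fun H x => finsetRank H (x / 2 ^ ρ)) fun p x => indexOfTests p.2 x)
    (Sum.elim (fun H i => finsetNth H i) fun p i => if h : i < k then p.1.1 ⟨i, h⟩ else 0)
    (hclog.trans hW) hρ fun S hS hk => ?_).mono le_rfl (Nat.add_le_add_right hclog _)
  have hlt : ∀ x ∈ S, x / 2 ^ ρ < V := fun x hx =>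
    Nat.lt_succ_of_le (Nat.div_le_div_right (Finset.mem_range.1 (hS hx)).le)
  by_cases hinj : Set.InjOn (· / 2 ^ ρ) (S : Set ℕ)
  · refine ⟨Sum.inl ⟨S.image (· / 2 ^ ρ), Finset.mem_powersetCard.2 ⟨fun z hz => ?_, ?_⟩⟩,
      fun x hx => ⟨finsetRank_image_div hinj hx, ?_⟩⟩
    · obtain ⟨x, hx, rfl⟩ := Finset.mem_image.1 hz
      exact Finset.mem_range.2 (hlt x hx)
    · rw [Finset.card_image_of_injOn hinj, hk]
    · rw [← finsetRank_image_div hinj hx]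
      exact finsetNth_finsetRank (Finset.mem_image_of_mem _ hx)
  · obtain ⟨D, hD⟩ := exists_tests
      (fun x hx => (Finset.mem_range.1 (hS hx)).trans_le hU) hk hlam
    refine ⟨Sum.inr (⟨fun i => ⟨finsetNth S i / 2 ^ ρ, hlt _ (finsetNth_mem (hk.symm ▸ i.2))⟩,
      fun h => hinj fun x hx y hy hxy => ?_⟩, D), fun x hx => ⟨hD x hx, ?_⟩⟩
    · have hx' : finsetRank S x < k := hk ▸ finsetRank_lt_card hx
      have hy' : finsetRank S y < k := hk ▸ finsetRank_lt_card hy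
      have := @h ⟨_, hx'⟩ ⟨_, hy'⟩ (Fin.ext (by
        simpa only [finsetNth_finsetRank hx, finsetNth_finsetRank hy] using hxy))
      exact finsetRank_injOn S hx hy (Fin.mk.inj_iff.1 this)
    · have hx' : finsetRank S x < k := hk ▸ finsetRank_lt_card hx
      simp only [Sum.elim_inr, dif_pos hx', finsetNth_finsetRank hx]

theorem clog_le_logb_add_one {N : ℕ} (hN : 0 < N) :
    (Nat.clog 2 N : ℝ) ≤ Real.logb 2 N + 1 := by
  have := Nat.ceil_lt_add_one (a := Real.logb 2 N)
    (Real.logb_nonneg one_lt_two (by exact_mod_cast hN))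
  rw [← Real.natCeil_logb_natCast] 
  exact_mod_cast this.le

/-- Sets that are small compared to the word size are stored with constant redundancy. -/
theorem HasDict.small {W U k lam b : ℕ} (hU : U ≤ 2 ^ lam) (hlam : 0 < lam) (hlW : lam ≤ W)
    (hk : 0 < k) (hkU : k ≤ U) (hb : k ^ (k + 2) * (2 * lam) ^ k ^ 2 ≤ 2 ^ b)
    (hbW : (b + 2) * k + 1 ≤ W) :
    ∃ ℓ : ℕ, (ℓ : ℝ) ≤ Real.logb 2 (U.choose k) + 3 ∧ HasDict W 2 U k ℓ := by
  have hCpos : 0 < U.choose k := Nat.choose_pos hkU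
  -- In a universe below `2 ^ b` the whole index of the set fits into one read.
  rcases lt_or_ge U (2 ^ b) with hUb | hUb
  · refine ⟨_, ?_, HasDict.of_index (W := W) ?_⟩
    · linarith [clog_le_logb_add_one hCpos]
    · refine Nat.clog_le_of_le_pow ((Nat.choose_le_pow U k).trans ?_)
      calc U ^ k ≤ (2 ^ b) ^ k := Nat.pow_le_pow_left hUb.le _
        _ = 2 ^ (b * k) := (pow_mul _ _ _).symm
        _ ≤ 2 ^ W := Nat.pow_le_pow_right two_pos (by nlinarith)
  have hU0 : U ≠ 0 := by omega
  -- This leaves `b + 1` leading bits: few enough for one read, enough to make coinciding leading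
  -- parts rare.
  set ρ := Nat.log 2 U - b with hρ
  have hbl : b ≤ Nat.log 2 U := Nat.le_log_of_pow_le one_lt_two hUb
  have hpow : 2 ^ b * 2 ^ ρ = 2 ^ Nat.log 2 U := by rw [← pow_add]; congr 1; omega
  set V := U / 2 ^ ρ with hV
  have hV1 : 2 ^ b ≤ V := by
    rw [hV, Nat.le_div_iff_mul_le (by positivity), hpow]
    exact Nat.pow_log_le_self 2 hU0
  have hV2 : V + 1 ≤ 2 ^ (b + 1) := by
    refine Nat.div_lt_of_lt_mul ?_
    calc U < 2 ^ (Nat.log 2 U + 1) := Nat.lt_pow_succ_log_self one_lt_two U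
      _ = 2 ^ ρ * 2 ^ (b + 1) := by rw [pow_succ, ← hpow]; ring
  have hlam2 : 1 ≤ (2 * lam) ^ k ^ 2 := Nat.one_le_pow _ _ (by omega)
  have h2k : 2 * k ≤ V + 1 := by
    have h1 : k ^ 2 ≤ k ^ (k + 2) := Nat.pow_le_pow_right hk (by omega)
    have h2 : k ^ (k + 2) ≤ V := (Nat.le_mul_of_pos_right _ hlam2).trans (hb.trans hV1)
    nlinarith
  have hkV : k ≤ V + 1 := by omega
  set Z := Fintype.card {f : Fin k → Fin (V + 1) // ¬ Function.Injective f} * (2 * lam) ^ k ^ 2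
    with hZ
  have hZle : Z ≤ (V + 1).choose k := by
    have h1 := card_not_injective_mul_le k (V + 1)
    have h2 := pow_le_pow_mul_choose hkV
    have h3 : k ^ (k + 2) * (2 * lam) ^ k ^ 2 ≤ V + 1 := by omega
    refine Nat.le_of_mul_le_mul_right ?_ (Nat.succ_pos V)
    calc Z * (V + 1) = Fintype.card {f : Fin k → Fin (V + 1) // ¬ Function.Injective f} * (V + 1)
          * (2 * lam) ^ k ^ 2 := by rw [hZ]; ring
      _ ≤ k ^ 2 * (k ^ k * (V + 1).choose k) * (2 * lam) ^ k ^ 2 :=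
          Nat.mul_le_mul_right _ (h1.trans (Nat.mul_le_mul_left _ h2))
      _ = (V + 1).choose k * (k ^ (k + 2) * (2 * lam) ^ k ^ 2) := by ring
      _ ≤ (V + 1).choose k * (V + 1) := Nat.mul_le_mul_left _ h3
  -- One half is for sets with distinct leading parts, the other for all the rest.
  set N := 2 * (V + 1).choose k with hN
  have hNpos : 0 < N := Nat.mul_pos two_pos (Nat.choose_pos hkV)
  -- The two kinds of codes and the step from `V + 1` to `V` cost a factor 2 each; with the rounding
  -- up of the logarithm this makes 3 bits.
  have hN4 : N * 2 ^ (k * ρ) ≤ 4 * U.choose k := by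
    calc N * 2 ^ (k * ρ) ≤ 2 * (2 * V.choose k) * 2 ^ (k * ρ) :=
          Nat.mul_le_mul_right _ (Nat.mul_le_mul_left _ (choose_succ_le_two_mul h2k))
      _ = 4 * (V.choose k * (2 ^ ρ) ^ k) := by rw [Nat.mul_comm k ρ, pow_mul]; ring
      _ ≤ 4 * (V * 2 ^ ρ).choose k :=
          Nat.mul_le_mul_left _ (choose_mul_pow_le _ _ _ (by positivity))
      _ ≤ 4 * U.choose k := Nat.mul_le_mul_left _
          (Nat.choose_le_choose _ (Nat.div_mul_le_self _ _))
  refine ⟨Nat.clog 2 N + k * ρ, ?_, HasDict.of_leading_parts hU hlam ?_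
    (by rw [← hV, ← hZ]; omega) ?_⟩
  · have h1 := clog_le_logb_add_one hNpos
    have h2 : Real.logb 2 (N * 2 ^ (k * ρ) : ℝ) ≤ Real.logb 2 (4 * U.choose k : ℝ) :=
      Real.logb_le_logb_of_le one_lt_two (by positivity) (by exact_mod_cast hN4)
    rw [Real.logb_mul (by positivity) (by positivity), Real.logb_mul (by positivity)
      (by positivity), Real.logb_pow, Real.logb_self_eq_one one_lt_two,
      show (4 : ℝ) = 2 ^ 2 by norm_num, Real.logb_pow, Real.logb_self_eq_one one_lt_two] at h2
    push_cast at h2 ⊢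
    linarith
  · have : Nat.log 2 U ≤ lam := by
      rw [← Nat.log_pow one_lt_two lam]; exact Nat.log_mono_right hU
    omega
  · refine Nat.clog_le_of_le_pow ?_
    calc N ≤ 2 * (2 ^ (b + 1)) ^ k := Nat.mul_le_mul_left _
          ((Nat.choose_le_pow _ _).trans (Nat.pow_le_pow_left hV2 _))
      _ = 2 ^ ((b + 1) * k + 1) := by
          rw [pow_succ 2 ((b + 1) * k), pow_mul 2 (b + 1) k, Nat.mul_comm]
      _ ≤ 2 ^ W := Nat.pow_le_pow_right two_pos (by nlinarith)

/-! ### Two-level hashing with families of functions known to the query algorithm. -/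

open Classical in
/-- If every `a ∈ A` is related to at least half of `B`, then few elements of `B` serve all of `A`. -/
theorem exists_cover {α β : Type} [Fintype β] [Nonempty β] (R : α → β → Prop) (F : ℕ) :
    ∀ A : Finset α, (∀ a ∈ A, Fintype.card β ≤ 2 * (Finset.univ.filter (R a)).card) →
      A.card < 2 ^ F → ∃ s : ℕ → β, ∀ a ∈ A, ∃ i < F, R a (s i) := by
  induction F with
  | zero =>
    intro A _ hA
    have : A = ∅ := Finset.card_eq_zero.1 (by simpa using hA)
    exact ⟨fun _ => Classical.arbitrary β, by simp [this]⟩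
  | succ F ih =>
    intro A hR hA
    -- By double counting, some `b` serves at least half of `A`; the induction goes on with the part
    -- not served.
    obtain ⟨b, -, hb⟩ : ∃ b ∈ (Finset.univ : Finset β),
        A.card ≤ 2 * (A.filter fun a => R a b).card := by
      refine Finset.exists_le_of_sum_le Finset.univ_nonempty ?_
      have h1 := Finset.sum_card_bipartiteAbove_eq_sum_card_bipartiteBelow
        (s := A) (t := (Finset.univ : Finset β)) R
      simp only [Finset.bipartiteAbove, Finset.bipartiteBelow] at h1
      calc ∑ _b : β, A.card = ∑ a ∈ A, Fintype.card β := by simp [Nat.mul_comm]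
        _ ≤ ∑ a ∈ A, 2 * (Finset.univ.filter (R a)).card := Finset.sum_le_sum hR
        _ = _ := by rw [← Finset.mul_sum, h1, Finset.mul_sum]
    obtain ⟨s, hs⟩ := ih (A.filter fun a => ¬ R a b)
      (fun a ha => hR a (Finset.mem_filter.1 ha).1) (by
        have := Finset.card_filter_add_card_filter_not (s := A) (fun a => R a b)
        rw [pow_succ] at hA
        omega)
    refine ⟨fun i => if i = F then b else s i, fun a ha => ?_⟩
    by_cases h : R a b
    · exact ⟨F, by omega, by simpa using h⟩
    · obtain ⟨i, hi, hai⟩ := hs a (Finset.mem_filter.2 ⟨ha, h⟩)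
      exact ⟨i, by omega, by simpa [hi.ne] using hai⟩

/-- The pairs of distinct members of `S` that collide under `h`. -/
def collisions (S : Finset ℕ) (h : ℕ → ℕ) : Finset (ℕ × ℕ) :=
  S.offDiag.filter fun p => h p.1 = h p.2

/-- A small family of hash functions to `N` values such that every `c`-element set has a member
of the family with few collisions. -/
theorem exists_hash_family {U lam c N M : ℕ} (hU : U ≤ 2 ^ lam) (hN : 0 < N)
    (hM : 2 * c ^ 2 ≤ N * (M + 1)) :
    ∃ H : ℕ → ℕ → ℕ, (∀ s x, H s x < N) ∧ ∀ S ⊆ Finset.range U, S.card = c →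
      ∃ s ≤ lam * c, (collisions S (H s)).card ≤ M := by
  classical
  have : Nonempty (Fin N) := ⟨⟨0, hN⟩⟩
  let ext : (Fin U → Fin N) → ℕ → ℕ := fun h x => if hx : x < U then h ⟨x, hx⟩ else 0
  have hext : ∀ h x, ext h x < N := fun h x => by
    by_cases hx : x < U
    · simp only [ext, dif_pos hx]; exact Fin.is_lt _
    · simpa only [ext, dif_neg hx] using hN
  -- Markov's inequality: a uniformly random function has at most `c ^ 2 / N` collisions on average,
  -- so at least half of all functions have at most `M`.
  have key : ∀ S ∈ Finset.powersetCard c (Finset.range U), Fintype.card (Fin U → Fin N) ≤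
      2 * (Finset.univ.filter fun h : Fin U → Fin N => (collisions S (ext h)).card ≤ M).card := by
    intro S hS
    obtain ⟨hSU, hSc⟩ := Finset.mem_powersetCard.1 hS
    have hcount : (∑ h : Fin U → Fin N, (collisions S (ext h)).card) * N ≤ c ^ 2 * N ^ U := by
      have h1 := Finset.sum_card_bipartiteAbove_eq_sum_card_bipartiteBelow
        (s := (Finset.univ : Finset (Fin U → Fin N))) (t := S.offDiag)
        (fun h p => ext h p.1 = ext h p.2)
      simp only [Finset.bipartiteAbove, Finset.bipartiteBelow] at h1
      simp only [collisions]
      rw [h1, Finset.sum_mul]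
      calc _ = ∑ p ∈ S.offDiag, N ^ U := Finset.sum_congr rfl fun p hp => by
              obtain ⟨hp1, hp2, hne⟩ := Finset.mem_offDiag.1 hp
              have hp1' := Finset.mem_range.1 (hSU hp1)
              have hp2' := Finset.mem_range.1 (hSU hp2)
              have := card_filter_apply_eq (x := (⟨p.1, hp1'⟩ : Fin U)) (y := ⟨p.2, hp2'⟩)
                (by simpa using hne) N
              rw [Fintype.card_fin] at this
              rw [← this]
              simp only [ext, dif_pos hp1', dif_pos hp2', Fin.val_inj]
        _ ≤ c ^ 2 * N ^ U := by
              rw [Finset.sum_const, smul_eq_mul, Finset.offDiag_card, hSc, sq]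
              exact Nat.mul_le_mul_right _ (Nat.sub_le _ _)
    have hbad : (Finset.univ.filter fun h : Fin U → Fin N =>
        ¬ (collisions S (ext h)).card ≤ M).card * (M + 1) ≤
        ∑ h : Fin U → Fin N, (collisions S (ext h)).card := by
      calc _ = ∑ h ∈ Finset.univ.filter fun h : Fin U → Fin N =>
              ¬ (collisions S (ext h)).card ≤ M, (M + 1) := by simp
        _ ≤ ∑ h ∈ Finset.univ.filter fun h : Fin U → Fin N =>
              ¬ (collisions S (ext h)).card ≤ M, (collisions S (ext h)).card :=
            Finset.sum_le_sum fun h hh => by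
              have := (Finset.mem_filter.1 hh).2
              omega
        _ ≤ _ := Finset.sum_le_sum_of_subset (Finset.filter_subset _ _)
    have hsplit := Finset.card_filter_add_card_filter_not
      (s := (Finset.univ : Finset (Fin U → Fin N))) (fun h => (collisions S (ext h)).card ≤ M)
    have hcard : Fintype.card (Fin U → Fin N) = N ^ U := by simp
    rw [Finset.card_univ, hcard] at hsplit
    rw [hcard]
    set bad := (Finset.univ.filter fun h : Fin U → Fin N =>
        ¬ (collisions S (ext h)).card ≤ M).card
    have h3 : 2 * bad * (N * (M + 1)) ≤ N ^ U * (N * (M + 1)) := by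
      calc 2 * bad * (N * (M + 1)) = 2 * (bad * (M + 1) * N) := by ring
        _ ≤ 2 * (c ^ 2 * N ^ U) := Nat.mul_le_mul_left _
            ((Nat.mul_le_mul_right _ hbad).trans hcount)
        _ = N ^ U * (2 * c ^ 2) := by ring
        _ ≤ _ := Nat.mul_le_mul_left _ hM
    have h4 := Nat.le_of_mul_le_mul_right h3 (by positivity)
    omega
  obtain ⟨s, hs⟩ := exists_cover (fun (S : Finset ℕ) (h : Fin U → Fin N) =>
    (collisions S (ext h)).card ≤ M) (lam * c + 1)
    (Finset.powersetCard c (Finset.range U)) (fun S hS => by convert key S hS) (by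
      rw [Finset.card_powersetCard, Finset.card_range, pow_succ, pow_mul]
      have : U.choose c ≤ (2 ^ lam) ^ c :=
        (Nat.choose_le_pow U c).trans (Nat.pow_le_pow_left hU c)
      have : 0 < (2 ^ lam) ^ c := by positivity
      omega)
  refine ⟨fun i => ext (s i), fun i x => hext _ _, fun S hS hc => ?_⟩
  obtain ⟨i, hi, h⟩ := hs S (Finset.mem_powersetCard.2 ⟨hS, hc⟩)
  exact ⟨i, by omega, h⟩

theorem sum_card_sq_eq_card_add_card_collisions {S : Finset ℕ} {h : ℕ → ℕ} {N : ℕ}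
    (hN : ∀ x ∈ S, h x < N) :
    ∑ b ∈ Finset.range N, (S.filter fun x => h x = b).card ^ 2 =
      S.card + (collisions S h).card := by
  have h1 : ((S ×ˢ S).filter fun p => h p.1 = h p.2).card = S.card + (collisions S h).card := by
    have hd := Finset.diag_union_offDiag S
    rw [← hd, Finset.filter_union, Finset.card_union_of_disjoint, collisions]
    · rw [Finset.filter_true_of_mem, Finset.diag_card]
      intro p hp
      rw [(Finset.mem_diag.1 hp).2]
    · exact Finset.disjoint_filter_filter (Finset.disjoint_diag_offDiag S)
  rw [← h1, Finset.card_eq_sum_card_fiberwise (f := fun p => h p.1) (t := Finset.range N)]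
  · refine Finset.sum_congr rfl fun b _ => ?_
    rw [sq, ← Finset.card_product]
    congr 1
    ext p
    simp only [Finset.mem_product, Finset.mem_filter]
    constructor
    · rintro ⟨⟨h1, h2⟩, h3, h4⟩
      exact ⟨⟨⟨h1, h3⟩, h2.trans h4.symm⟩, h2⟩
    · rintro ⟨⟨⟨h1, h3⟩, h2⟩, h4⟩
      exact ⟨⟨h1, h4⟩, h3, h2 ▸ h4⟩
  · intro p hp
    have hp := Finset.mem_filter.1 (Finset.mem_coe.1 hp)
    exact Finset.mem_coe.2 (Finset.mem_range.2 (hN _ (Finset.mem_product.1 hp.1).1))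

theorem injOn_of_card_collisions_le_zero {S : Finset ℕ} {h : ℕ → ℕ}
    (hc : (collisions S h).card ≤ 0) : Set.InjOn h (S : Set ℕ) := fun x hx y hy hxy => by
  by_contra hne
  have : (x, y) ∈ collisions S h := Finset.mem_filter.2 ⟨Finset.mem_offDiag.2 ⟨hx, hy, hne⟩, hxy⟩
  exact (Finset.card_pos.2 ⟨_, this⟩).not_ge hc

/-- Hashing in two levels finds a number attached to each member of a set, with a linear number
of words. -/
theorem exists_lookup {W U k lam v : ℕ} (hU : U ≤ 2 ^ lam) (hk : 0 < k)
    (hv : lam * k < 2 ^ v) (hv' : 6 * k < 2 ^ v) (hvW : v ≤ W) :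
    ∃ look : ℕ → BitMem → ℕ, (∀ x, Probing W 5 (look x)) ∧
      ∀ S ⊆ Finset.range U, S.card = k → ∀ f : ℕ → ℕ, (∀ x ∈ S, f x < 2 ^ v) →
        ∃ a : ℕ → ℕ, ∀ mem : BitMem, (∀ p < (1 + 3 * k + 6 * k) * v, mem p = BitMem.array v a p) →
          ∀ x ∈ S, look x mem = f x := by
  classical
  -- With `k` buckets and at most `2 * k` collisions, the squares of the bucket sizes sum to at most
  -- `3 * k`. A bucket of size `c` gets `2 * c ^ 2` slots, enough for a collision-free function, so
  -- `6 * k` slots suffice.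
  obtain ⟨H, hH, hHS⟩ := exists_hash_family (c := k) (N := k) (M := 2 * k) hU hk (by nlinarith)
  have h2 : ∀ c, ∃ G : ℕ → ℕ → ℕ, 0 < c → (∀ s x, G s x < 2 * c ^ 2) ∧
      ∀ S ⊆ Finset.range U, S.card = c → ∃ s ≤ lam * c, Set.InjOn (G s) (S : Set ℕ) := fun c => by
    rcases Nat.eq_zero_or_pos c with rfl | hc
    · exact ⟨fun _ _ => 0, fun h => absurd h (lt_irrefl 0)⟩
    · obtain ⟨G, hG, hGS⟩ := exists_hash_family (c := c) (N := 2 * c ^ 2) (M := 0) hU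
        (by positivity) (by omega)
      refine ⟨G, fun _ => ⟨hG, fun S hS hc => ?_⟩⟩
      obtain ⟨s, hs, h⟩ := hGS S hS hc
      exact ⟨s, hs, injOn_of_card_collisions_le_zero h⟩
  choose G hG using h2
  let rd : BitMem → ℕ → ℕ := fun mem i => mem.readNat (0 + i * v) v
  have hrd : ∀ i, Probing W 1 (fun mem => rd mem i) := fun i => Probing.readNat hvW _
  refine ⟨fun x mem => rd mem (1 + 3 * k + (rd mem (1 + 2 * k + H (rd mem 0) x) +
      G (rd mem (1 + k + H (rd mem 0) x)) (rd mem (1 + H (rd mem 0) x)) x)), fun x => ?_,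
    fun S hS hSk f hf => ?_⟩
  · refine (hrd 0).bind (t := 4) (g := fun s mem => rd mem (1 + 3 * k + (rd mem (1 + 2 * k + H s x)
      + G (rd mem (1 + k + H s x)) (rd mem (1 + H s x)) x))) fun s => ?_
    refine (hrd (1 + 2 * k + H s x)).bind (t := 3) (g := fun o mem => rd mem (1 + 3 * k + (o
      + G (rd mem (1 + k + H s x)) (rd mem (1 + H s x)) x))) fun o => ?_
    refine (hrd (1 + k + H s x)).bind (t := 2) (g := fun c mem => rd mem (1 + 3 * k + (o
      + G c (rd mem (1 + H s x)) x))) fun c => ?_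
    exact (hrd (1 + H s x)).bind (t := 1) (g := fun s' mem => rd mem (1 + 3 * k + (o
      + G c s' x))) fun s' => hrd _
  · obtain ⟨s, hs, hcoll⟩ := hHS S hS hSk
    let B : ℕ → Finset ℕ := fun b => S.filter fun x => H s x = b
    let o : ℕ → ℕ := fun b => ∑ b' ∈ Finset.range b, 2 * (B b').card ^ 2
    have ho : o k ≤ 6 * k := by
      have := sum_card_sq_eq_card_add_card_collisions (S := S) (h := H s) (N := k)
        (fun x _ => hH s x)
      simp only [o, ← Finset.mul_sum, B]
      rw [this]
      omega
    have homono : Monotone o := fun a b hab =>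
      Finset.sum_le_sum_of_subset (Finset.range_subset_range.2 hab)
    have hex : ∀ b, ∃ s' ≤ lam * (B b).card, 0 < (B b).card →
        Set.InjOn (G (B b).card s') (B b : Set ℕ) := fun b => by
      rcases Nat.eq_zero_or_pos (B b).card with h0 | h0
      · exact ⟨0, Nat.zero_le _, fun h => by omega⟩
      · obtain ⟨s', h1, h2⟩ := (hG _ h0).2 (B b) ((Finset.filter_subset _ _).trans hS) rfl
        exact ⟨s', h1, fun _ => h2⟩
    choose s' hs' hinj using hex
    let slot : ℕ → ℕ := fun x => o (H s x) + G (B (H s x)).card (s' (H s x)) x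
    have hB : ∀ x ∈ S, 0 < (B (H s x)).card := fun x hx =>
      Finset.card_pos.2 ⟨x, Finset.mem_filter.2 ⟨hx, rfl⟩⟩
    have hslot : ∀ x ∈ S, slot x < o (H s x + 1) := fun x hx => by
      have := (hG _ (hB x hx)).1 (s' (H s x)) x
      simp only [slot, o, Finset.sum_range_succ] at this ⊢
      omega
    have hslotk : ∀ x ∈ S, slot x < 6 * k := fun x hx =>
      (hslot x hx).trans_le ((homono (hH s x)).trans ho)
    have hslotinj : Set.InjOn slot (S : Set ℕ) := fun x hx y hy hxy => by
      have hb : H s x = H s y := by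
        rcases lt_trichotomy (H s x) (H s y) with h | h | h
        · have h1 := (hslot x hx).trans_le (homono h)
          simp only [slot] at hxy h1
          omega
        · exact h
        · have h1 := (hslot y hy).trans_le (homono h)
          simp only [slot] at hxy h1
          omega
      refine hinj _ (hB x hx) (Finset.mem_filter.2 ⟨hx, rfl⟩) (Finset.mem_filter.2 ⟨hy, hb.symm⟩) ?_
      simp only [slot, ← hb] at hxy
      omega
    let tab : ℕ → ℕ := fun q => if h : ∃ x ∈ S, slot x = q then f h.choose else 0
    have htab : ∀ x ∈ S, tab (slot x) = f x := fun x hx => by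
      have h : ∃ y ∈ S, slot y = slot x := ⟨x, hx, rfl⟩
      simp only [tab, dif_pos h]
      rw [hslotinj h.choose_spec.1 hx h.choose_spec.2]
    -- The fields are the index of the outer function, then for each bucket the index of its inner
    -- function, its size and its offset, and finally the slots.
    let a : ℕ → ℕ := fun i => if i < 1 then s else if i < 1 + k then s' (i - 1) else
      if i < 1 + 2 * k then (B (i - (1 + k))).card else
      if i < 1 + 3 * k then o (i - (1 + 2 * k)) else tab (i - (1 + 3 * k))
    refine ⟨a, fun mem hmem x hx => ?_⟩
    have read : ∀ i y, i < 1 + 3 * k + 6 * k → a i = y → y < 2 ^ v → rd mem i = y :=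
      fun i y hi hy hlt => by
        rw [← hy]
        exact BitMem.readNat_array (fun p hp => by rw [Nat.zero_add, hmem p hp]) hi (hy ▸ hlt)
    have hBk : ∀ b, (B b).card ≤ k := fun b => hSk ▸ Finset.card_filter_le _ _
    have hx' := hH s x
    have r0 : rd mem 0 = s := read _ _ (by omega) (by simp [a]) (hs.trans_lt hv)
    have r1 : rd mem (1 + H s x) = s' (H s x) := read _ _ (by omega)
      (by simp only [a]; rw [if_neg (by omega), if_pos (by omega), Nat.add_sub_cancel_left])
      ((hs' _).trans_lt ((Nat.mul_le_mul_left _ (hBk _)).trans_lt hv))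
    have r2 : rd mem (1 + k + H s x) = (B (H s x)).card := read _ _ (by omega)
      (by simp only [a]; rw [if_neg (by omega), if_neg (by omega), if_pos (by omega),
            Nat.add_sub_cancel_left])
      ((hBk _).trans_lt (by omega))
    have r3 : rd mem (1 + 2 * k + H s x) = o (H s x) := read _ _ (by omega)
      (by simp only [a]; rw [if_neg (by omega), if_neg (by omega), if_neg (by omega),
            if_pos (by omega), Nat.add_sub_cancel_left])
      (((homono hx'.le).trans ho).trans_lt hv')
    have r4 : rd mem (1 + 3 * k + slot x) = f x := read _ _ (by have := hslotk x hx; omega)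
      (by simp only [a]; rw [if_neg (by omega), if_neg (by omega), if_neg (by omega),
            if_neg (by omega), Nat.add_sub_cancel_left, htab x hx])
      (hf x hx)
    simp only [r0, r1, r2, r3]
    exact r4

/-- A sorted list of the members, together with a hash table for their ranks. -/
theorem HasDict.of_hashing {W U k lam v β : ℕ} (hU : U ≤ 2 ^ lam) (hk : 0 < k)
    (hv : lam * k < 2 ^ v) (hv' : 6 * k < 2 ^ v) (hvW : v ≤ W) (hβ : U ≤ 2 ^ β) (hβW : β ≤ W) :
    HasDict W 5 U k ((1 + 3 * k + 6 * k) * v + k * β) := by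
  obtain ⟨look, hlook, hl⟩ := exists_lookup hU hk hv hv' hvW
  refine ⟨look, fun i mem => mem.readNat ((1 + 3 * k + 6 * k) * v + i * β) β, hlook,
    fun i => (Probing.readNat hβW _).mono (by omega), fun S hS hSk => ?_⟩
  obtain ⟨a, ha⟩ := hl S hS hSk (finsetRank S) (fun x hx =>
    (finsetRank_lt_card hx).trans_le (by omega))
  refine ⟨.append ((1 + 3 * k + 6 * k) * v) (.array v a) (.array β (finsetNth S)),
    fun mem hmem x hx => ⟨?_, ?_⟩⟩
  · exact ha mem (fun p hp => by
      rw [hmem p (by omega), BitMem.append_left _ _ hp]) x hx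
  · have := BitMem.readNat_array (mem := mem) (b := (1 + 3 * k + 6 * k) * v) (N := k)
      (i := finsetRank S x) (a := finsetNth S) (v := β) (fun p hp => by
        rw [hmem _ (by omega), BitMem.append_right]) (hSk ▸ finsetRank_lt_card hx)
      (by rw [finsetNth_finsetRank hx]; exact (Finset.mem_range.1 (hS hx)).trans_le hβ)
    exact this.trans (finsetNth_finsetRank hx)

/-! ### Cutting the universe into blocks, with a directory for rank and selection. -/

/-- The part of `S` in the `i`-th block of `u` consecutive numbers, moved to the origin. -/
def finsetBlock (S : Finset ℕ) (u i : ℕ) : Finset ℕ := (S.filter (· / u = i)).image (· % u)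

theorem mod_injOn_filter_div (S : Finset ℕ) (u i : ℕ) :
    Set.InjOn (· % u) (S.filter (· / u = i) : Set ℕ) := fun x hx y hy hxy => by
  have hx' := (Finset.mem_filter.1 (Finset.mem_coe.1 hx)).2
  have hy' := (Finset.mem_filter.1 (Finset.mem_coe.1 hy)).2
  have hxy' : x % u = y % u := hxy
  rw [← Nat.div_add_mod x u, ← Nat.div_add_mod y u, hx', hy', hxy']

theorem mod_mem_finsetBlock {S : Finset ℕ} {x : ℕ} (hx : x ∈ S) (u : ℕ) :
    x % u ∈ finsetBlock S u (x / u) :=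
  Finset.mem_image_of_mem _ (Finset.mem_filter.2 ⟨hx, rfl⟩)

theorem card_finsetBlock (S : Finset ℕ) (u i : ℕ) :
    (finsetBlock S u i).card = (S.filter (· / u = i)).card :=
  Finset.card_image_of_injOn (mod_injOn_filter_div S u i)

theorem finsetRank_eq_add_finsetBlock (S : Finset ℕ) {u : ℕ} (hu : 0 < u) (x : ℕ) :
    finsetRank S x = finsetRank S (x / u * u) + finsetRank (finsetBlock S u (x / u)) (x % u) := by
  have h1 : (finsetBlock S u (x / u)).filter (· < x % u) =
      (S.filter fun y => y / u = x / u ∧ y % u < x % u).image (· % u) := by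
    ext z
    simp only [finsetBlock, Finset.mem_filter, Finset.mem_image]
    constructor
    · rintro ⟨⟨y, ⟨h1, h2⟩, rfl⟩, h3⟩
      exact ⟨y, ⟨h1, h2, h3⟩, rfl⟩
    · rintro ⟨y, ⟨h1, h2, h3⟩, rfl⟩
      exact ⟨⟨y, ⟨h1, h2⟩, rfl⟩, h3⟩
  have h2 : S.filter (· < x) = S.filter (· < x / u * u) ∪
      S.filter fun y => y / u = x / u ∧ y % u < x % u := by
    rw [← Finset.filter_or]
    refine Finset.filter_congr fun y _ => ?_
    rw [← Nat.div_lt_iff_lt_mul hu]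
    constructor
    · intro h
      rcases (Nat.div_le_div_right (c := u) h.le).lt_or_eq with h' | h'
      · exact Or.inl h'
      · refine Or.inr ⟨h', ?_⟩
        have h3 := Nat.div_add_mod x u
        have h4 := Nat.div_add_mod y u
        rw [h'] at h4
        omega
    · rintro (h | ⟨h, h'⟩)
      · exact Nat.lt_of_div_lt_div h
      · have h3 := Nat.div_add_mod x u
        have h4 := Nat.div_add_mod y u
        rw [h] at h4
        omega
  unfold finsetRank
  rw [h1, h2, Finset.card_union_of_disjoint, Finset.card_image_of_injOn]
  · exact (mod_injOn_filter_div S u (x / u)).mono fun y hy => by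
      have hy := Finset.mem_filter.1 (Finset.mem_coe.1 hy)
      exact Finset.mem_coe.2 (Finset.mem_filter.2 ⟨hy.1, hy.2.1⟩)
  · refine Finset.disjoint_filter.2 fun y _ hy h => ?_
    rw [← Nat.div_lt_iff_lt_mul hu] at hy
    exact hy.ne h.1

/-- The universe is cut into `T` blocks of size `u`, whose parts of the set are stored one after the
other. A directory of numbers of `v` bits tells for each block the rank of its first member, the
number of its members and the address of its part, and for each run of `R` ranks the block of the
first one, together with the list of all blocks if they are not the same. -/
theorem HasDict.blocks {W t U n u T R J v D : ℕ} (ℓ : ℕ → ℕ → ℕ) (hu : 0 < u) (hT : U ≤ T * u)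
    (hR : 0 < R) (hJ : n ≤ J * R) (hvW : v ≤ W)
    (h : ∀ i < T, ∀ k ≤ n, k ≤ min u (U - i * u) → HasDict W t (min u (U - i * u)) k (ℓ i k))
    (hD : ∀ k : ℕ → ℕ, (∀ i < T, k i ≤ min u (U - i * u)) → ∑ i ∈ Finset.range T, k i = n →
      ∑ i ∈ Finset.range T, ℓ i (k i) ≤ D)
    (hnv : n < 2 ^ v) (hDv : D < 2 ^ v) (hTv : 2 * T < 2 ^ v) :
    HasDict W (t + 5) U n ((3 * T + J + T * R) * v + D) := by
  classical
  -- The conditions on `i` and `k` move inside the existential, so that algorithms can be chosen for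
  -- all indices, with constant ones outside the range.
  have h' : ∀ i k, ∃ rank select : ℕ → BitMem → ℕ,
      (∀ x, Probing W t (rank x)) ∧ (∀ i, Probing W t (select i)) ∧
      (i < T → k ≤ n → k ≤ min u (U - i * u) → ∀ S ⊆ Finset.range (min u (U - i * u)),
        S.card = k → ∃ e : BitMem, ∀ mem : BitMem, (∀ p < ℓ i k, mem p = e p) →
        ∀ x ∈ S, rank x mem = finsetRank S x ∧ select (finsetRank S x) mem = x) := fun i k => by
    by_cases hc : i < T ∧ k ≤ n ∧ k ≤ min u (U - i * u)
    · obtain ⟨rank, select, h1, h2, h3⟩ := h i hc.1 k hc.2.1 hc.2.2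
      exact ⟨rank, select, h1, h2, fun _ _ _ => h3⟩
    · exact ⟨fun _ _ => 0, fun _ _ => 0, fun _ => .const _, fun _ => .const _,
        fun h1 h2 h3 => absurd ⟨h1, h2, h3⟩ hc⟩
  choose rank select hrank hselect hspec using h'
  set M := 3 * T + J + T * R with hM
  let rd : BitMem → ℕ → ℕ := fun mem i => mem.readNat (0 + i * v) v
  have hrd : ∀ i, Probing W 1 (fun mem => rd mem i) := fun i => Probing.readNat hvW _
  -- the answer to a query `F` about block `i`
  let inBlock : (ℕ → ℕ → ℕ → BitMem → ℕ) → ℕ → BitMem → ℕ := fun F i mem =>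
    F i (rd mem i) (rd mem (T + i)) (mem.shift (M * v + rd mem (2 * T + i)))
  have hinBlock : ∀ F : ℕ → ℕ → ℕ → BitMem → ℕ, (∀ i r k, Probing W t (F i r k)) → ∀ i,
      Probing W (t + 3) (inBlock F i) := fun F hF i => by
    refine Probing.mono (s := 1 + (1 + (1 + t))) ?_ (by omega)
    refine (hrd i).bind (g := fun r mem =>
      F i r (rd mem (T + i)) (mem.shift (M * v + rd mem (2 * T + i)))) fun r => ?_
    refine (hrd (T + i)).bind (g := fun k mem =>
      F i r k (mem.shift (M * v + rd mem (2 * T + i)))) fun k => ?_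
    exact (hrd (2 * T + i)).bind (g := fun A mem =>
      F i r k (mem.shift (M * v + A))) fun A => (hF i r k).shift _
  let rankIn : ℕ → ℕ → ℕ → ℕ → BitMem → ℕ := fun x i r k mem => r + rank i k (x % u) mem
  let selectIn : ℕ → ℕ → ℕ → ℕ → BitMem → ℕ := fun q i r k mem =>
    i * u + select i k (q - r) mem
  refine ⟨fun x => inBlock (rankIn x) (x / u), fun q mem =>
    inBlock (selectIn q) (if rd mem (3 * T + q / R) % 2 = 0 then rd mem (3 * T + q / R) / 2 else
      rd mem (3 * T + J + (rd mem (3 * T + q / R) / 2 * R + q % R))) mem,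
    fun x => (hinBlock _ (fun i r k => (hrank i k _).map fun a => r + a) _).mono (by omega),
    fun q => ?_, fun S hS hSn => ?_⟩
  · refine Probing.mono (s := 1 + (1 + (t + 3))) ?_ (by omega)
    refine (hrd (3 * T + q / R)).bind (g := fun c mem => inBlock (selectIn q) (if c % 2 = 0 then
      c / 2 else rd mem (3 * T + J + (c / 2 * R + q % R))) mem) fun c => ?_
    have hsel := hinBlock (selectIn q) (fun i r k => (hselect i k _).map fun a => i * u + a)
    by_cases hc : c % 2 = 0
    · simp only [if_pos hc]
      exact (hsel _).mono (by omega)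
    · simp only [if_neg hc]
      exact (hrd _).bind hsel
  have hlt : ∀ x ∈ S, x < U := fun x hx => Finset.mem_range.1 (hS hx)
  have hdivT : ∀ x ∈ S, x / u < T := fun x hx =>
    (Nat.div_lt_iff_lt_mul hu).2 ((hlt x hx).trans_le hT)
  let k : ℕ → ℕ := fun i => (finsetBlock S u i).card
  have hsub : ∀ i, finsetBlock S u i ⊆ Finset.range (min u (U - i * u)) := fun i z hz => by
    obtain ⟨x, hx, rfl⟩ := Finset.mem_image.1 hz
    obtain ⟨hxS, rfl⟩ := Finset.mem_filter.1 hx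
    have h1 := Nat.div_add_mod' x u
    have h2 := Nat.mod_lt x hu
    have h3 := hlt x hxS
    rw [Finset.mem_range, lt_min_iff]
    omega
  have hk : ∀ i, k i ≤ min u (U - i * u) := fun i => by
    simpa using Finset.card_le_card (hsub i)
  have hkn : ∀ i, k i ≤ n := fun i => by
    simp only [k, card_finsetBlock, ← hSn]
    exact Finset.card_filter_le _ _
  have hksum : ∑ i ∈ Finset.range T, k i = n := by
    rw [← hSn, Finset.card_eq_sum_card_fiberwise (f := (· / u)) (t := Finset.range T)]
    · exact Finset.sum_congr rfl fun i _ => card_finsetBlock S u i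
    · exact fun x hx => Finset.mem_coe.2 (Finset.mem_range.2 (hdivT x hx))
  have hlen := hD k (fun i _ => hk i) hksum
  have hexe : ∀ i, ∃ e : BitMem, i < T → ∀ mem : BitMem, (∀ p < ℓ i (k i), mem p = e p) →
      ∀ x ∈ finsetBlock S u i, rank i (k i) x mem = finsetRank (finsetBlock S u i) x ∧
        select i (k i) (finsetRank (finsetBlock S u i) x) mem = x := fun i => by
    by_cases hi : i < T
    · obtain ⟨e, he⟩ := hspec i (k i) hi (hkn i) (hk i) _ (hsub i) rfl
      exact ⟨e, fun _ => he⟩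
    · exact ⟨fun _ => false, fun h => absurd h hi⟩
  choose e he using hexe
  obtain ⟨data, hdata⟩ := BitMem.exists_concat (fun i => ℓ i (k i)) e T
  let A : ℕ → ℕ := fun i => ∑ i' ∈ Finset.range i, ℓ i' (k i')
  have hA : ∀ i < T, A i + ℓ i (k i) ≤ D := fun i hi => by
    refine le_trans ?_ hlen
    calc A i + ℓ i (k i) = ∑ i' ∈ Finset.range (i + 1), ℓ i' (k i') :=
          (Finset.sum_range_succ _ _).symm
      _ ≤ _ := Finset.sum_le_sum_of_subset (Finset.range_subset_range.2 hi)
  let blk : ℕ → ℕ := fun q => finsetNth S q / u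
  have hblkT : ∀ q < n, blk q < T := fun q hq => hdivT _ (finsetNth_mem (hSn ▸ hq))
  have hblkmono : ∀ q q', q ≤ q' → q' < n → blk q ≤ blk q' := fun q q' h1 h2 =>
    Nat.div_le_div_right (finsetNth_mono (hSn ▸ h2) h1)
  let mixed : ℕ → Prop := fun j => ∃ q < n, q / R = j ∧ blk q ≠ blk (j * R)
  -- A run that leaves its first block ends beyond it, so at most one mixed run starts in each
  -- block. The list of such a run can be filed under that block, and `T` lists of `R` entries
  -- suffice.
  have hmixed : ∀ j j', mixed j → mixed j' → blk (j * R) = blk (j' * R) → ¬ j < j' := by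
    rintro j j' ⟨q, hq, rfl, hne⟩ ⟨q', hq', rfl, -⟩ heq hlt
    have h1 : q / R * R ≤ q := Nat.div_mul_le_self _ _
    have h2 : q' / R * R ≤ q' := Nat.div_mul_le_self _ _
    have h3 : q < (q / R + 1) * R := by
      have := Nat.lt_div_mul_add (a := q) hR
      rw [Nat.add_mul]; omega
    have h4 : (q / R + 1) * R ≤ q' / R * R := Nat.mul_le_mul_right _ hlt
    have h5 := hblkmono _ _ h1 hq
    have h6 := hblkmono q (q' / R * R) (by omega) (by omega)
    omega
  let spill : ℕ → ℕ → ℕ := fun i o =>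
    if h : ∃ j, mixed j ∧ blk (j * R) = i then blk (h.choose * R + o) else 0
  have h_spill : ∀ j o, mixed j → spill (blk (j * R)) o = blk (j * R + o) := fun j o hj => by
    have hex : ∃ j', mixed j' ∧ blk (j' * R) = blk (j * R) := ⟨j, hj, rfl⟩
    obtain ⟨h1, h2⟩ := hex.choose_spec
    simp only [spill, dif_pos hex]
    rw [Nat.le_antisymm (not_lt.1 (hmixed _ _ hj h1 h2.symm)) (not_lt.1 (hmixed _ _ h1 hj h2))]
  -- The parity of a run's entry tells whether the run is mixed; half of the entry is the first
  -- block.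
  let a : ℕ → ℕ := fun i => if i < T then finsetRank S (i * u) else
    if i < 2 * T then k (i - T) else if i < 3 * T then A (i - 2 * T) else
    if i < 3 * T + J then 2 * blk ((i - 3 * T) * R) + (if mixed (i - 3 * T) then 1 else 0) else
    spill ((i - (3 * T + J)) / R) ((i - (3 * T + J)) % R)
  refine ⟨.append (M * v) (.array v a) data, fun mem hmem x hx => ?_⟩
  have read : ∀ i y, i < M → a i = y → y < 2 ^ v → rd mem i = y := fun i y hi hy hlt => by
    rw [← hy]
    exact BitMem.readNat_array (N := M) (fun p hp => by
      rw [Nat.zero_add, hmem p (by omega), BitMem.append_left _ _ hp]) hi (hy ▸ hlt)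
  have r1 : ∀ i < T, rd mem i = finsetRank S (i * u) := fun i hi => read _ _ (by omega)
    (by simp only [a]; rw [if_pos hi]) ((finsetRank_le_card _ _).trans_lt (hSn ▸ hnv))
  have r2 : ∀ i < T, rd mem (T + i) = k i := fun i hi => read _ _ (by omega)
    (by simp only [a]; rw [if_neg (by omega), if_pos (by omega), Nat.add_sub_cancel_left])
    ((hkn i).trans_lt hnv)
  have r3 : ∀ i < T, rd mem (2 * T + i) = A i := fun i hi => read _ _ (by omega)
    (by simp only [a]; rw [if_neg (by omega), if_neg (by omega), if_pos (by omega),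
          Nat.add_sub_cancel_left])
    (lt_of_le_of_lt (by have := hA i hi; omega) hDv)
  have hi := hdivT x hx
  have hdat : ∀ p < ℓ (x / u) (k (x / u)),
      mem.shift (M * v + rd mem (2 * T + x / u)) p = e (x / u) p := fun p hp => by
    have h1 := hA _ hi
    rw [r3 _ hi, BitMem.shift, Nat.add_assoc, hmem _ (by omega), BitMem.append_right]
    exact hdata _ hi p hp
  obtain ⟨hr, hs⟩ := he _ hi _ hdat _ (mod_mem_finsetBlock hx u)
  have hsplit := finsetRank_eq_add_finsetBlock S hu x
  refine ⟨?_, ?_⟩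
  · simp only [inBlock, rankIn]
    rw [r2 _ hi, hr, r1 _ hi, hsplit]
  · set q := finsetRank S x with hq
    have hqn : q < n := hSn ▸ finsetRank_lt_card hx
    have hqJ : q / R < J := (Nat.div_lt_iff_lt_mul hR).2 (hqn.trans_le hJ)
    have hqR : q / R * R ≤ q := Nat.div_mul_le_self _ _
    have hblkq : blk q = x / u := by simp only [blk, hq, finsetNth_finsetRank hx]
    have hb0 := hblkT _ (hqR.trans_lt hqn)
    have hqnn : (0 : ℤ) ≤ (q : ℤ) / (R : ℤ) := by positivity
    have r4 : rd mem (3 * T + q / R) =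
        2 * blk (q / R * R) + (if mixed (q / R) then 1 else 0) := by
      refine read _ _ (by omega) ?_ ?_
      · simp only [a]
        rw [if_neg (by omega), if_neg (by omega), if_neg (by omega), if_pos (by omega),
          Nat.add_sub_cancel_left]
      · split_ifs <;> omega
    have key : (if rd mem (3 * T + q / R) % 2 = 0 then rd mem (3 * T + q / R) / 2 else
        rd mem (3 * T + J + (rd mem (3 * T + q / R) / 2 * R + q % R))) = x / u := by
      by_cases hm : mixed (q / R)
      · rw [if_pos hm] at r4
        have h1 : rd mem (3 * T + q / R) / 2 = blk (q / R * R) := by omega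
        rw [if_neg (by omega), h1]
        have hmod := Nat.mod_lt q hR
        refine read _ _ ?_ ?_ (by omega)
        · have : blk (q / R * R) * R + q % R < T * R := by
            calc _ < (blk (q / R * R) + 1) * R := by rw [Nat.add_mul]; omega
              _ ≤ T * R := Nat.mul_le_mul_right _ hb0
          omega
        · simp only [a]
          rw [if_neg (by omega), if_neg (by omega), if_neg (by omega), if_neg (by omega),
            Nat.add_sub_cancel_left, Nat.mul_comm (blk _) R, Nat.mul_add_div hR,
            Nat.div_eq_of_lt hmod, Nat.mul_add_mod, Nat.mod_eq_of_lt hmod, Nat.add_zero,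
            h_spill _ _ hm, Nat.div_add_mod', hblkq]
      · rw [if_neg hm] at r4
        rw [if_pos (by omega), r4]
        have : blk q = blk (q / R * R) := by
          by_contra hne
          exact hm ⟨q, hqn, rfl, hne⟩
        omega
    simp only [inBlock, selectIn]
    rw [key, r2 _ hi, r1 _ hi, hsplit, Nat.add_sub_cancel_left, hs]
    exact Nat.div_add_mod' x u

/-! ### The slack in the encoding of crowded blocks. -/

theorem choose_mul_choose_le_choose_add (a b c d : ℕ) :
    a.choose b * c.choose d ≤ (a + c).choose (b + d) := by
  rw [Nat.add_choose_eq]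
  exact Finset.single_le_sum (f := fun ij : ℕ × ℕ => a.choose ij.1 * c.choose ij.2)
    (fun _ _ => Nat.zero_le _) (Finset.HasAntidiagonal.mem_antidiagonal.2 (rfl : (b, d).1 + (b, d).2 = b + d))

theorem sum_min_sub_mul (u U T : ℕ) :
    ∑ i ∈ Finset.range T, min u (U - i * u) = min (T * u) U := by
  induction T with
  | zero => simp
  | succ T ih =>
    rw [Finset.sum_range_succ, ih, Nat.add_mul]
    omega

/-- Raising the set size from `a + b` to `a + b + 1` multiplies the binomial coefficient by `(U - (a
+ b)) / (a + b + 1)`, which is at least `U / (2 * n)`. So the whole encoding has room for `lg (U /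
(2 * n))` bits per member of a crowded block. -/
theorem choose_mul_pow_le_choose_add {U n a b : ℕ} (hn : 0 < n) (hU : 2 * n ≤ U)
    (hab : a + b ≤ n) :
    (U.choose a : ℝ) * ((U : ℝ) / (2 * n)) ^ b ≤ U.choose (a + b) := by
  induction b with
  | zero => simp
  | succ b ih =>
    have h1 : (U.choose (a + b + 1) : ℝ) * (a + b + 1) = U.choose (a + b) * (U - (a + b)) := by
      have := Nat.choose_succ_right_eq U (a + b)
      rw [← Nat.cast_inj (R := ℝ)] at this
      push_cast [Nat.cast_sub (show a + b ≤ U by omega)] at this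
      exact this
    have hn' : (0 : ℝ) < n := by exact_mod_cast hn
    have hU' : 2 * (n : ℝ) ≤ U := by exact_mod_cast hU
    have hab' : (a : ℝ) + b + 1 ≤ n := by exact_mod_cast hab
    have h2 : (U : ℝ) / (2 * n) * (a + b + 1) ≤ U - (a + b) := by
      rw [div_mul_eq_mul_div, div_le_iff₀ (by positivity)]
      nlinarith
    have h3 : (0 : ℝ) < a + b + 1 := by positivity
    refine le_of_mul_le_mul_right ?_ h3
    rw [← Nat.add_assoc, h1]
    calc _ = (U.choose a * ((U : ℝ) / (2 * n)) ^ b) * ((U : ℝ) / (2 * n) * (a + b + 1)) := by ring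
      _ ≤ U.choose (a + b) * ((U : ℝ) / (2 * n) * (a + b + 1)) :=
          mul_le_mul_of_nonneg_right (ih (by omega)) (by positivity)
      _ ≤ _ := mul_le_mul_of_nonneg_left h2 (by positivity)

theorem choose_le_three_mul_div_pow {u k : ℕ} (hk : 0 < k) :
    (u.choose k : ℝ) ≤ (3 * u / k) ^ k := by
  have h1 := Nat.choose_le_pow_div (α := ℝ) k u
  have h2 := Real.pow_div_factorial_le_exp (k : ℝ) (by positivity) k
  have h3 : Real.exp k ≤ 3 ^ k := by
    rw [← Real.exp_one_pow]
    exact pow_le_pow_left₀ (Real.exp_pos _).le (Real.exp_one_lt_d9.le.trans (by norm_num)) _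
  have hk' : (0 : ℝ) < k := by exact_mod_cast hk
  have hf : (0 : ℝ) < k.factorial := by positivity
  refine h1.trans ?_
  rw [div_pow, mul_pow, div_le_div_iff₀ hf (by positivity)]
  have h4 : (k : ℝ) ^ k ≤ 3 ^ k * k.factorial := (div_le_iff₀ hf).1 (h2.trans h3)
  calc (u : ℝ) ^ k * (k : ℝ) ^ k ≤ u ^ k * (3 ^ k * k.factorial) :=
        mul_le_mul_of_nonneg_left h4 (by positivity)
    _ = _ := by ring

/-- A block with many more members than its share has few possible contents. -/
theorem logb_choose_le_of_crowded {u s U n γ k : ℕ} (hsu : s ≤ u) (hks : k ≤ s) (hn : 0 < n)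
    (hun : u * n ≤ γ * U) (hk : (6 * γ) ^ 2 ≤ k) (hk0 : 0 < k) :
    Real.logb 2 (s.choose k) + 1 / 2 * (k * Real.logb 2 k) ≤
      k * Real.logb 2 ((U : ℝ) / (2 * n)) := by
  have hu : 0 < u := by omega
  have hU : 0 < U := by
    rcases Nat.eq_zero_or_pos U with rfl | h
    · have := Nat.mul_pos hu hn; omega
    · exact h
  have hu' : (0 : ℝ) < u := by exact_mod_cast hu
  have hU' : (0 : ℝ) < U := by exact_mod_cast hU
  have hn' : (0 : ℝ) < n := by exact_mod_cast hn
  have hk' : (0 : ℝ) < k := by exact_mod_cast hk0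
  have h1 : Real.logb 2 (s.choose k) ≤ k * Real.logb 2 (3 * u / k) := by
    rw [← Real.logb_pow]
    refine Real.logb_le_logb_of_le one_lt_two ?_ ?_
    · exact_mod_cast Nat.choose_pos hks
    · exact le_trans (by exact_mod_cast Nat.choose_le_choose k hsu)
        (choose_le_three_mul_div_pow hk0)
  -- As `6 * γ` is at most the square root of `k`, the quotient `3 * u / k` is at most `U / (2 * n)`
  -- divided by that square root, hence the half logarithm.
  have h2 : 2 * Real.logb 2 (3 * u / k) + Real.logb 2 k ≤
      2 * Real.logb 2 ((U : ℝ) / (2 * n)) := by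
    have e1 : 2 * Real.logb 2 (3 * u / k) = Real.logb 2 ((3 * u / k : ℝ) ^ 2) := by
      rw [Real.logb_pow]; norm_num
    have e2 : 2 * Real.logb 2 ((U : ℝ) / (2 * n)) = Real.logb 2 (((U : ℝ) / (2 * n)) ^ 2) := by
      rw [Real.logb_pow]; norm_num
    rw [e1, e2, ← Real.logb_mul (by positivity) (by positivity)]
    refine Real.logb_le_logb_of_le one_lt_two (by positivity) ?_
    have e3 : (3 * u / k : ℝ) ^ 2 * k = 9 * u ^ 2 / k := by field_simp; ring
    rw [e3, div_pow, div_le_div_iff₀ hk' (by positivity)]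
    have hun' : (u : ℝ) * n ≤ γ * U := by exact_mod_cast hun
    have hk2 : (6 * γ : ℝ) ^ 2 ≤ k := by exact_mod_cast hk
    calc 9 * (u : ℝ) ^ 2 * (2 * n) ^ 2 = 36 * (u * n) ^ 2 := by ring
      _ ≤ 36 * (γ * U : ℝ) ^ 2 := by gcongr
      _ = (6 * γ : ℝ) ^ 2 * U ^ 2 := by ring
      _ ≤ k * (U : ℝ) ^ 2 := by gcongr
      _ = (U : ℝ) ^ 2 * k := by ring
  nlinarith

/-- The sizes of the parts of a set in blocks of `u` numbers are such that an optimal encoding of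
the parts has a slack of half the binary logarithm of its size per member of a crowded block. -/
theorem sum_logb_choose_add_le {T u U n γ τ : ℕ} {k : ℕ → ℕ} (hn : 0 < n) (hnU : n ≤ U)
    (hun : u * n ≤ γ * U) (hτ : (6 * γ) ^ 2 ≤ τ)
    (hk : ∀ i < T, k i ≤ min u (U - i * u)) (hsum : ∑ i ∈ Finset.range T, k i = n) :
    ∑ i ∈ Finset.range T, (Real.logb 2 ((min u (U - i * u)).choose (k i)) +
      if τ < k i then 1 / 2 * (k i * Real.logb 2 (k i)) else 0) ≤ Real.logb 2 (U.choose n) := by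
  set s : ℕ → ℕ := fun i => min u (U - i * u) with hs
  set x : ℝ := (U : ℝ) / (2 * n) with hx
  -- Members of sparse blocks are counted by `a` and merged by Vandermonde's inequality; those of
  -- crowded blocks are counted by `b` and charged `lg x` bits each.
  let a : ℕ → ℕ := fun N => ∑ i ∈ Finset.range N, if τ < k i then 0 else k i
  let b : ℕ → ℕ := fun N => ∑ i ∈ Finset.range N, if τ < k i then k i else 0
  have hab : a T + b T = n := by
    rw [← hsum, ← Finset.sum_add_distrib]
    exact Finset.sum_congr rfl fun i _ => by split_ifs <;> omega
  have has : ∀ N ≤ T, a N ≤ ∑ i ∈ Finset.range N, s i := fun N hN =>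
    Finset.sum_le_sum fun i hi => by
      have := hk i ((Finset.mem_range.1 hi).trans_le hN)
      split_ifs
      · omega
      · exact this
  have main : ∀ N ≤ T, ∑ i ∈ Finset.range N, (Real.logb 2 ((s i).choose (k i)) +
      if τ < k i then 1 / 2 * (k i * Real.logb 2 (k i)) else 0) ≤
      Real.logb 2 ((∑ i ∈ Finset.range N, s i).choose (a N)) + b N * Real.logb 2 x := by
    intro N
    induction N with
    | zero => simp [a, b]
    | succ N ih =>
      intro hN
      have ih := ih (by omega)
      have hkN := hk N (by omega)
      have hpos : (0 : ℝ) < (∑ i ∈ Finset.range N, s i).choose (a N) := by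
        exact_mod_cast Nat.choose_pos (has N (by omega))
      have hposk : (0 : ℝ) < (s N).choose (k N) := by exact_mod_cast Nat.choose_pos hkN
      rw [Finset.sum_range_succ, Finset.sum_range_succ]
      have ha : a (N + 1) = a N + if τ < k N then 0 else k N := Finset.sum_range_succ _ _
      have hb : b (N + 1) = b N + if τ < k N then k N else 0 := Finset.sum_range_succ _ _
      by_cases hl : τ < k N
      · simp only [if_pos hl] at ha hb ⊢
        have h1 := logb_choose_le_of_crowded (s := s N) (min_le_left _ _) hkN hn hun
          (hτ.trans hl.le) (by omega)
        have h2 : Real.logb 2 ((∑ i ∈ Finset.range N, s i).choose (a N)) ≤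
            Real.logb 2 ((∑ i ∈ Finset.range N, s i + s N).choose (a N)) :=
          Real.logb_le_logb_of_le one_lt_two hpos
            (by exact_mod_cast Nat.choose_le_choose _ (Nat.le_add_right _ _))
        rw [ha, hb, Nat.add_zero]
        push_cast
        linarith
      · simp only [if_neg hl] at ha hb ⊢
        have h2 : Real.logb 2 ((∑ i ∈ Finset.range N, s i).choose (a N)) +
            Real.logb 2 ((s N).choose (k N)) ≤
            Real.logb 2 ((∑ i ∈ Finset.range N, s i + s N).choose (a N + k N)) := by
          rw [← Real.logb_mul hpos.ne' hposk.ne']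
          exact Real.logb_le_logb_of_le one_lt_two (by positivity)
            (by exact_mod_cast choose_mul_choose_le_choose_add _ _ _ _)
        rw [ha, hb, Nat.add_zero]
        linarith
  refine (main T le_rfl).trans ?_
  have hsU : ∑ i ∈ Finset.range T, s i ≤ U := by
    rw [hs, sum_min_sub_mul]; exact min_le_right _ _
  have h1 : Real.logb 2 ((∑ i ∈ Finset.range T, s i).choose (a T)) ≤
      Real.logb 2 (U.choose (a T)) :=
    Real.logb_le_logb_of_le one_lt_two (by exact_mod_cast Nat.choose_pos (has T le_rfl))
      (by exact_mod_cast Nat.choose_le_choose _ hsU)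
  rcases Nat.eq_zero_or_pos (b T) with hb | hb
  · rw [hb, Nat.add_zero] at hab
    rw [hb, ← hab]
    simpa using h1
  · obtain ⟨i, hi, hbi⟩ : ∃ i ∈ Finset.range T, 0 < if τ < k i then k i else 0 := by
      by_contra! h0
      have : b T = 0 := Finset.sum_eq_zero fun i hi => Nat.le_zero.1 (h0 i hi)
      omega
    have hl : τ < k i := by
      by_contra hl
      simp [hl] at hbi
    have hiu : k i ≤ u := (hk i (Finset.mem_range.1 hi)).trans (min_le_left _ _)
    have hγ : 0 < γ := by
      rcases Nat.eq_zero_or_pos γ with rfl | h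
      · have := Nat.mul_pos (show 0 < u by omega) hn
        omega
      · exact h
    -- A crowded block has more than `(6 * γ) ^ 2` members, and it must have room for them.
    have h2n : 2 * n ≤ U := by
      have h3 : γ * (2 * n) ≤ γ * U := by
        calc γ * (2 * n) ≤ (6 * γ) ^ 2 * n := by nlinarith [Nat.mul_le_mul_right n hγ]
          _ ≤ u * n := Nat.mul_le_mul_right _ (by omega)
          _ ≤ γ * U := hun
      exact Nat.le_of_mul_le_mul_left h3 hγ
    have hxpos : 0 < x := by
      have : (0 : ℝ) < n := by exact_mod_cast hn
      have : (0 : ℝ) < U := by exact_mod_cast hn.trans_le hnU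
      positivity
    have hca : (0 : ℝ) < U.choose (a T) := by exact_mod_cast Nat.choose_pos (by omega)
    have h4 := Real.logb_le_logb_of_le one_lt_two (by positivity)
      (choose_mul_pow_le_choose_add hn h2n hab.le)
    rw [Real.logb_mul hca.ne' (by positivity), Real.logb_pow, hab] at h4
    linarith

/-! ### Redundancy, and its reduction level by level. -/

/-- There is a data structure as in `HasDict` whose length exceeds the information-theoretic lower
bound by at most `r` bits. -/
def HasSuccinctDict (W t U k : ℕ) (r : ℝ) : Prop :=
  ∃ ℓ : ℕ, (ℓ : ℝ) ≤ Real.logb 2 (U.choose k) + r ∧ HasDict W t U k ℓ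

theorem HasSuccinctDict.mono {W s t U k : ℕ} {r r' : ℝ} (h : HasSuccinctDict W s U k r)
    (hst : s ≤ t) (hr : r ≤ r') : HasSuccinctDict W t U k r' := by
  obtain ⟨ℓ, h1, h2⟩ := h
  exact ⟨ℓ, by linarith, h2.mono hst le_rfl⟩

theorem logb_natCast_nonneg (n : ℕ) : 0 ≤ Real.logb 2 (n : ℝ) := by
  rcases Nat.eq_zero_or_pos n with rfl | h
  · simp
  · exact Real.logb_nonneg one_lt_two (by exact_mod_cast h)

theorem logb_natCast_le {n lam : ℕ} (h : n ≤ 2 ^ lam) : Real.logb 2 (n : ℝ) ≤ lam := by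
  rcases Nat.eq_zero_or_pos n with rfl | h0
  · simp
  · have := Real.logb_le_logb_of_le one_lt_two (by exact_mod_cast h0 : (0 : ℝ) < n)
      (by exact_mod_cast h : (n : ℝ) ≤ 2 ^ lam)
    rwa [Real.logb_pow, Real.logb_self_eq_one one_lt_two, mul_one] at this

theorem logb_choose_le {U n lam : ℕ} (hU : U ≤ 2 ^ lam) :
    Real.logb 2 (U.choose n : ℝ) ≤ n * lam := by
  have := logb_natCast_le (n := U.choose n) (lam := lam * n)
    ((Nat.choose_le_pow U n).trans ((Nat.pow_le_pow_left hU n).trans (by rw [pow_mul])))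
  push_cast at this
  linarith

/-- One level of cutting into blocks reduces the redundancy by `k lg k / 2` bits. -/
theorem HasSuccinctDict.blocks {W t lam τ N v j : ℕ} {ε ε' : ℝ} (hlam : 0 < lam)
    (hε' : ε ≤ ε') (hε0 : 0 ≤ ε) (hε1 : ε' ≤ 1) (hv : 0 < v) (hvW : v ≤ W) (hτ : (6 * v ^ 5) ^ 2 ≤ τ)
    (hN : N * lam * (j + 6) < 2 ^ v)
    (small : ∀ U ≤ 2 ^ lam, ∀ k ≤ τ, k ≤ U → HasSuccinctDict W t U k (ε * k + v))
    (large : ∀ U ≤ 2 ^ lam, ∀ k, τ < k → k ≤ N → k ≤ U →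
      HasSuccinctDict W t U k ((j + 1) / 2 * (k * Real.logb 2 k) + ε' * k))
    {U n : ℕ} (hU : U ≤ 2 ^ lam) (hn : τ < n) (hnN : n ≤ N) (hnU : n ≤ U) :
    HasSuccinctDict W (t + 5) U n (j / 2 * (n * Real.logb 2 n) + (ε' + 17 / v) * n) := by
  have hn0 : 0 < n := by omega
  have hγ : 1 ≤ v ^ 5 := Nat.one_le_pow _ _ hv
  have hγn : v ^ 5 ≤ n := by nlinarith
  -- Blocks have an average of about `v ^ 5` members, so even `v ^ 2` spill entries of `v` bits per
  -- block are affordable.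
  set u := v ^ 5 * U / n with hu
  have hun : u * n ≤ v ^ 5 * U := Nat.div_mul_le_self _ _
  have hUγ : n ≤ v ^ 5 * U := hnU.trans (Nat.le_mul_of_pos_left _ hγ)
  have hu0 : 0 < u := Nat.div_pos hUγ hn0
  have h2un : v ^ 5 * U ≤ 2 * n * u := by
    have := Nat.lt_div_mul_add (a := v ^ 5 * U) hn0
    rw [← hu] at this
    nlinarith
  set T := U / u + 1 with hT
  have hUT : U ≤ T * u := by
    have := Nat.lt_div_mul_add (a := U) hu0
    rw [hT, Nat.add_mul]; omega
  have hTγ : v ^ 5 * T ≤ 3 * n := by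
    have hU0 : 0 < U := by omega
    have h1 : U / u * v ^ 5 ≤ 2 * n := by
      refine Nat.le_of_mul_le_mul_right ?_ hU0
      calc U / u * v ^ 5 * U = U / u * (v ^ 5 * U) := by ring
        _ ≤ U / u * (2 * n * u) := Nat.mul_le_mul_left _ h2un
        _ = 2 * n * (U / u * u) := by ring
        _ ≤ 2 * n * U := Nat.mul_le_mul_left _ (Nat.div_mul_le_self _ _)
    rw [hT]; nlinarith
  set R := v ^ 2 with hR
  have hR0 : 0 < R := by positivity
  set J := n / R + 1 with hJ
  have hJn : n ≤ J * R := by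
    have := Nat.lt_div_mul_add (a := n) hR0
    rw [hJ, Nat.add_mul]; omega
  have hJR : v ^ 2 * J ≤ 2 * n := by
    have h1 := Nat.div_mul_le_self n R
    have h2 : R ≤ v ^ 5 := Nat.pow_le_pow_right hv (by norm_num)
    rw [hJ, ← hR]; nlinarith
  have hlen : ∀ U' k : ℕ, ∃ ℓ : ℕ, U' ≤ 2 ^ lam → k ≤ N → k ≤ U' →
      (ℓ : ℝ) ≤ Real.logb 2 (U'.choose k) + (if τ < k then
        (j + 1) / 2 * (k * Real.logb 2 k) + ε' * k else ε * k + v) ∧ HasDict W t U' k ℓ := by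
    intro U' k
    by_cases hc : U' ≤ 2 ^ lam ∧ k ≤ N ∧ k ≤ U'
    · obtain ⟨h1, h2, h3⟩ := hc
      by_cases hk : τ < k
      · obtain ⟨ℓ, hℓ⟩ := large U' h1 k hk h2 h3
        exact ⟨ℓ, fun _ _ _ => by simpa only [if_pos hk] using hℓ⟩
      · obtain ⟨ℓ, hℓ⟩ := small U' h1 k (not_lt.1 hk) h3
        exact ⟨ℓ, fun _ _ _ => by simpa only [if_neg hk] using hℓ⟩
    · exact ⟨0, fun h1 h2 h3 => absurd ⟨h1, h2, h3⟩ hc⟩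
  choose ℓ hℓ using hlen
  have hs : ∀ i, min u (U - i * u) ≤ 2 ^ lam := fun i =>
    (min_le_right _ _).trans ((Nat.sub_le _ _).trans hU)
  -- The space for the block contents after the slack is used: half of `k lg k` has disappeared, and
  -- `T * v` pays for the additive term of the sparse blocks.
  set E : ℝ := Real.logb 2 (U.choose n) + j / 2 * (n * Real.logb 2 n) + ε' * n + T * v with hE
  have hε'0 : 0 ≤ ε' := hε0.trans hε'
  have hE0 : 0 ≤ E := by
    have h1 := logb_natCast_nonneg (U.choose n)
    have h2 := logb_natCast_nonneg n
    positivity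
  have hvr : (1 : ℝ) ≤ v := by exact_mod_cast hv
  have hTr : (v : ℝ) ^ 5 * T ≤ 3 * n := by exact_mod_cast hTγ
  have hJr : (v : ℝ) ^ 2 * J ≤ 2 * n := by exact_mod_cast hJR
  have hpow : ∀ i ≤ 5, (v : ℝ) ^ i * T ≤ 3 * n := fun i hi =>
    (mul_le_mul_of_nonneg_right (pow_le_pow_right₀ hvr hi) (Nat.cast_nonneg T)).trans hTr
  have hDv : ⌊E⌋₊ < 2 ^ v := by
    refine lt_of_le_of_lt (Nat.floor_le_of_le ?_) hN
    have h1 := logb_choose_le (n := n) hU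
    have h2 := logb_natCast_le (hnU.trans hU)
    have h3 : (n : ℝ) ≤ N := by exact_mod_cast hnN
    have h4 : (1 : ℝ) ≤ lam := by exact_mod_cast hlam
    have h5 : (v : ℝ) * T ≤ 3 * n := by simpa using hpow 1 (by norm_num)
    have h6 : (n : ℝ) * Real.logb 2 n ≤ n * lam := by gcongr
    have h7 : (j : ℝ) / 2 * (n * Real.logb 2 n) ≤ j / 2 * (n * lam) := by gcongr
    have h8 : (n : ℝ) ≤ n * lam := le_mul_of_one_le_right (Nat.cast_nonneg _) h4
    have h9 : ε' * n ≤ n := mul_le_of_le_one_left (Nat.cast_nonneg _) hε1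
    have h10 : 0 ≤ (j : ℝ) * (n * lam) := by positivity
    push_cast
    calc E ≤ (n * lam : ℝ) * (j + 6) := by rw [hE]; linarith
      _ ≤ N * lam * (j + 6) := by gcongr
  refine ⟨(3 * T + J + T * R) * v + ⌊E⌋₊, ?_, HasDict.blocks (fun i k => ℓ (min u (U - i * u)) k)
    hu0 hUT hR0 hJn hvW (fun i _ k hkn hk => (hℓ _ _ (hs i) (hkn.trans hnN) hk).2)
    (fun k hk hsum => ?_) ?_ hDv ?_⟩
  · have hfl := Nat.floor_le hE0
    -- After multiplication by `v`, the four parts cost at most `9 * n`, `2 * n`, `3 * n` and `3 *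
    -- n`.
    have hdir : ((3 * T + J + T * R : ℕ) : ℝ) * v + T * v ≤ 17 / v * n := by
      rw [div_mul_eq_mul_div, le_div_iff₀ (by positivity), hR]
      push_cast
      have h2 := hpow 2 (by norm_num)
      have h4 := hpow 4 (by norm_num)
      nlinarith
    push_cast at hdir ⊢
    linarith
  · refine Nat.le_floor ?_
    have hkn : ∀ i < T, k i ≤ n := fun i hi => by
      rw [← hsum]
      exact Finset.single_le_sum (f := k) (fun _ _ => Nat.zero_le _) (Finset.mem_range.2 hi)
    have hslack := sum_logb_choose_add_le hn0 hnU hun hτ hk hsum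
    have hsum' : ∑ i ∈ Finset.range T, (k i : ℝ) = n := by exact_mod_cast hsum
    have hln := logb_natCast_nonneg n
    push_cast
    calc ∑ i ∈ Finset.range T, (ℓ (min u (U - i * u)) (k i) : ℝ)
        ≤ ∑ i ∈ Finset.range T, ((Real.logb 2 ((min u (U - i * u)).choose (k i)) +
          if τ < k i then 1 / 2 * (k i * Real.logb 2 (k i)) else 0) +
          (j / 2 * Real.logb 2 n * k i + ε' * k i + v)) := by
          refine Finset.sum_le_sum fun i hi => ?_
          have hi := Finset.mem_range.1 hi
          have hki := hkn i hi
          have h1 := (hℓ _ _ (hs i) (hki.trans hnN) (hk i hi)).1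
          have hk0 : (0 : ℝ) ≤ k i := Nat.cast_nonneg _
          have hj0 : (0 : ℝ) ≤ j := Nat.cast_nonneg _
          split_ifs at h1 ⊢ with hl
          · have hlog : Real.logb 2 (k i) ≤ Real.logb 2 n :=
              Real.logb_le_logb_of_le one_lt_two (by exact_mod_cast (show 0 < k i by omega))
                (by exact_mod_cast hki)
            have : (j : ℝ) / 2 * (k i * Real.logb 2 (k i)) ≤ j / 2 * Real.logb 2 n * k i := by
              rw [mul_assoc, mul_comm (Real.logb 2 (n : ℝ))]
              gcongr
            linarith
          · have h2 : ε * k i ≤ ε' * k i := mul_le_mul_of_nonneg_right hε' hk0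
            have h3 : 0 ≤ (j : ℝ) / 2 * Real.logb 2 n * k i := by positivity
            linarith
      _ ≤ E := by
          rw [Finset.sum_add_distrib]
          refine (add_le_add_left hslack _).trans ?_
          rw [Finset.sum_add_distrib, Finset.sum_add_distrib, ← Finset.mul_sum,
            ← Finset.mul_sum, hsum', Finset.sum_const, Finset.card_range,
            nsmul_eq_mul, hE]
          linarith
  · refine lt_of_le_of_lt ?_ hN
    nlinarith [Nat.mul_le_mul hnN hlam]
  · refine lt_of_le_of_lt ?_ hN
    have : T ≤ v ^ 5 * T := Nat.le_mul_of_pos_left _ hγ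
    have : n * 1 * 6 ≤ N * lam * (j + 6) := Nat.mul_le_mul (Nat.mul_le_mul hnN hlam) (by omega)
    omega

/-- Finitely many levels of cutting into blocks remove a redundancy of `O(k lg k)` bits. -/
theorem HasSuccinctDict.iterate_blocks {W t lam τ N v j : ℕ} {ε : ℝ} (hlam : 0 < lam)
    (hε0 : 0 ≤ ε) (hε1 : ε + 17 * j / v ≤ 1) (hv : 0 < v) (hvW : v ≤ W)
    (hτ : (6 * v ^ 5) ^ 2 ≤ τ) (hN : N * lam * (j + 6) < 2 ^ v)
    (small : ∀ U ≤ 2 ^ lam, ∀ k ≤ τ, k ≤ U → HasSuccinctDict W t U k (ε * k + v))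
    (large : ∀ U ≤ 2 ^ lam, ∀ k, τ < k → k ≤ N → k ≤ U →
      HasSuccinctDict W t U k (j / 2 * (k * Real.logb 2 k) + ε * k))
    {U n : ℕ} (hU : U ≤ 2 ^ lam) (hn : τ < n) (hnN : n ≤ N) (hnU : n ≤ U) :
    HasSuccinctDict W (t + 5 * j) U n ((ε + 17 * j / v) * n) := by
  have key : ∀ i ≤ j, ∀ U ≤ 2 ^ lam, ∀ k, τ < k → k ≤ N → k ≤ U →
      HasSuccinctDict W (t + 5 * i) U k
        ((j - i : ℕ) / 2 * (k * Real.logb 2 k) + (ε + 17 * i / v) * k) := by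
    intro i
    induction i with
    | zero => simpa using large
    | succ i ih =>
      intro hi U hU k hk hkN hkU
      have ih := ih (by omega)
      have hvr : (0 : ℝ) < v := by exact_mod_cast hv
      have hle : ε + 17 * i / v ≤ ε + 17 * j / v := by
        have : (i : ℝ) ≤ j := by exact_mod_cast (show i ≤ j by omega)
        gcongr
      -- Sparse blocks use the given structure at every level, so only crowded ones recurse and
      -- accumulate `17 / v` per member.
      have := HasSuccinctDict.blocks (W := W) (t := t + 5 * i) (τ := τ) (N := N) (v := v)
        (j := j - (i + 1)) (ε := ε) (ε' := ε + 17 * i / v) hlam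
        (le_add_of_nonneg_right (by positivity)) hε0 (hle.trans hε1) hv hvW hτ
        ((Nat.mul_le_mul_left _ (by omega)).trans_lt hN)
        (fun U hU k hk hkU => (small U hU k hk hkU).mono (by omega) le_rfl)
        (fun U hU k hk hkN hkU => by
          have := ih U hU k hk hkN hkU
          rw [show j - i = j - (i + 1) + 1 by omega] at this
          exact_mod_cast this)
        hU hk hkN hkU
      refine this.mono (by omega) (le_of_eq ?_)
      push_cast
      ring
  simpa using key j le_rfl U hU n hn hnN hnU

theorem logb_le_clog (n : ℕ) : Real.logb 2 (n : ℝ) ≤ Nat.clog 2 n := by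
  have := Nat.le_ceil (Real.logb 2 (n : ℝ))
  rw [← Real.natCeil_logb_natCast]
  exact_mod_cast this

/-! ### Choice of parameters: small, medium and arbitrary sets. -/

/-- The parameter `L` is large enough for all estimates below. -/
structure IsLargeLog (L : ℕ) : Prop where
  pow_le : 2 ^ 200 * (L / 8 + 1) ^ 10 ≤ 2 ^ (L / 8)

theorem exists_isLargeLog : ∃ L₀, ∀ L ≥ L₀, IsLargeLog L := by
  have h := tendsto_pow_const_div_const_pow_of_one_lt 10 (r := (2 : ℝ)) one_lt_two
  have h2 := (h.comp (Filter.tendsto_add_atTop_nat 1)).eventually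
    (gt_mem_nhds (show (0 : ℝ) < 1 / 2 ^ 201 by positivity))
  obtain ⟨q₀, hq⟩ := Filter.eventually_atTop.1 h2
  refine ⟨8 * q₀, fun L hL => ⟨?_⟩⟩
  have h3 := hq (L / 8) (by omega)
  simp only [Function.comp] at h3
  rw [div_lt_div_iff₀ (by positivity) (by positivity)] at h3
  have h4 : ((L / 8 + 1 : ℕ) : ℝ) ^ 10 * 2 ^ 200 < 2 ^ (L / 8) := by
    rw [pow_succ (2 : ℝ) (L / 8), show (2 : ℝ) ^ 201 = 2 ^ 200 * 2 by rw [← pow_succ]] at h3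
    linarith
  have h5 : (L / 8 + 1) ^ 10 * 2 ^ 200 < 2 ^ (L / 8) := by exact_mod_cast h4
  rw [Nat.mul_comm]
  exact h5.le

namespace IsLargeLog

variable {L : ℕ}

theorem two_hundred_le (h : IsLargeLog L) : 200 ≤ L / 8 :=
  (Nat.pow_le_pow_iff_right (one_lt_two)).1
    ((Nat.le_mul_of_pos_right _ (by positivity)).trans h.pow_le)

theorem base_le (h : IsLargeLog L) : L + 8 ≤ 2 ^ (L / 8) := by
  refine le_trans ?_ h.pow_le
  have h1 : 8 ≤ 2 ^ 200 := by norm_num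
  have h2 : L / 8 + 1 ≤ (L / 8 + 1) ^ 10 := Nat.le_self_pow (by norm_num) _
  have h3 := Nat.mul_le_mul h1 h2
  omega

theorem pow_lt_of_le {lam : ℕ} (hL : L = Nat.clog 2 lam) (h : IsLargeLog L) : 2 ^ L < 2 * lam := by
  have h200 := h.two_hundred_le
  have hlam : 1 < lam := by
    by_contra hc
    rw [Nat.clog_of_right_le_one (by omega)] at hL
    omega
  have h1 := Nat.pow_pred_clog_lt_self one_lt_two hlam
  rw [← hL] at h1
  calc 2 ^ L = 2 * 2 ^ L.pred := by
        rw [← pow_succ']; congr 1; exact (Nat.succ_pred (by omega)).symm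
    _ < 2 * lam := by omega

end IsLargeLog

/-- The code takes about `5 * L * k ^ 3` bits. With `k ≤ 2 ^ (L / 8)` this is at most about `2 ^ (L
/ 2)`, well below the length `4 * lam` of a read. -/
theorem hasSuccinctDict_small {lam L : ℕ} (hL : L = Nat.clog 2 lam) (h : IsLargeLog L)
    {U k : ℕ} (hU : U ≤ 2 ^ lam) (hk : k ≤ 2 ^ (L / 8)) (hkU : k ≤ U) :
    HasSuccinctDict (4 * lam) 2 U k 3 := by
  have h200 := h.two_hundred_le
  have hlam2 := h.pow_lt_of_le hL
  have hlamL : lam ≤ 2 ^ L := hL ▸ Nat.le_pow_clog one_lt_two lam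
  have hlam : 0 < lam := by
    have : 0 < 2 ^ L := by positivity
    omega
  rcases Nat.eq_zero_or_pos k with rfl | hk0
  · refine ⟨0, by simp, ?_⟩
    have := HasDict.of_index (W := 4 * lam) (U := U) (k := 0) (by simp)
    simpa using this
  have hk2 : k ≤ k ^ 2 := Nat.le_self_pow two_ne_zero _
  refine HasDict.small (b := 5 * L * k ^ 2) hU hlam (by omega) hk0 hkU ?_ ?_
  · have hkL : k ≤ 2 ^ L := hk.trans (Nat.pow_le_pow_right two_pos (Nat.div_le_self _ _))
    calc k ^ (k + 2) * (2 * lam) ^ k ^ 2 ≤ (2 ^ L) ^ (k + 2) * (2 ^ (L + 1)) ^ k ^ 2 := by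
          refine Nat.mul_le_mul (Nat.pow_le_pow_left hkL _) (Nat.pow_le_pow_left ?_ _)
          rw [pow_succ]; omega
      _ = 2 ^ (L * (k + 2) + (L + 1) * k ^ 2) := by rw [← pow_mul, ← pow_mul, ← pow_add]
      _ ≤ 2 ^ (5 * L * k ^ 2) := by
          refine Nat.pow_le_pow_right two_pos ?_
          have h1 : L * (k + 2) ≤ L * (3 * k ^ 2) := Nat.mul_le_mul_left _ (by omega)
          have h2 : (L + 1) * k ^ 2 ≤ (2 * L) * k ^ 2 := Nat.mul_le_mul_right _ (by omega)
          nlinarith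
  · have h1 : (5 * L * k ^ 2 + 2) * k + 1 ≤ (L + 8) * 2 ^ 3 * k ^ 3 := by
      have : k ≤ k ^ 3 := Nat.le_self_pow (by norm_num) _
      have : 0 ≤ L * k ^ 3 := Nat.zero_le _
      nlinarith
    refine h1.trans ?_
    calc (L + 8) * 2 ^ 3 * k ^ 3 ≤ 2 ^ (L / 8) * 2 ^ 3 * (2 ^ (L / 8)) ^ 3 :=
          Nat.mul_le_mul (Nat.mul_le_mul_right _ h.base_le) (Nat.pow_le_pow_left hk _)
      _ = 2 ^ (L / 8 * 4 + 3) := by rw [← pow_mul, ← pow_add, ← pow_add]; congr 1; ring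
      _ ≤ 2 ^ L := Nat.pow_le_pow_right two_pos (by omega)
      _ ≤ 4 * lam := by omega

/-- Above this threshold `L` is `O(lg k)`, so a hash table field has `O(lg k)` bits. The sorted list
wastes `O(k lg k)` bits because `lg (U choose k) ≥ k lg U - k lg k`. -/
theorem hasSuccinctDict_large {lam L : ℕ} (hL : L = Nat.clog 2 lam) (h : IsLargeLog L)
    {U k : ℕ} (hU : U ≤ 2 ^ lam) (hk : 2 ^ (L / 8) < k) (hkU : k ≤ U) :
    HasSuccinctDict (4 * lam) 5 U k ((444 : ℕ) / 2 * (k * Real.logb 2 k)) := by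
  have h200 := h.two_hundred_le
  have hlamL : lam ≤ 2 ^ L := hL ▸ Nat.le_pow_clog one_lt_two lam
  have hlam2 := h.pow_lt_of_le hL
  have hLlam : L + 3 ≤ 3 * lam := by
    have := Nat.lt_two_pow_self (n := L)
    omega
  have hk0 : 0 < k := (Nat.zero_le _).trans_lt hk
  set κ := Nat.clog 2 k with hκ
  have hkκ : k ≤ 2 ^ κ := Nat.le_pow_clog one_lt_two k
  have hκlam : κ ≤ lam := Nat.clog_le_of_le_pow (hkU.trans hU)
  set β := Nat.clog 2 U with hβ
  refine ⟨_, ?_, HasDict.of_hashing (v := L + κ + 3) (β := β) hU hk0 ?_ ?_ (by omega)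
    (Nat.le_pow_clog one_lt_two U) ((Nat.clog_le_of_le_pow hU).trans (by omega))⟩
  · have hlogk : ((L / 8 : ℕ) : ℝ) ≤ Real.logb 2 k := by
      have := Real.logb_le_logb_of_le one_lt_two (by positivity)
        (by exact_mod_cast hk.le : (2 : ℝ) ^ (L / 8) ≤ k)
      rwa [Real.logb_pow, Real.logb_self_eq_one one_lt_two, mul_one] at this
    have h200r : (200 : ℝ) ≤ (L / 8 : ℕ) := by exact_mod_cast h200
    have hLr : (L : ℝ) ≤ 8 * (L / 8 : ℕ) + 7 := by
      exact_mod_cast (show L ≤ 8 * (L / 8) + 7 by omega)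
    have hκr : (κ : ℝ) ≤ Real.logb 2 k + 1 := clog_le_logb_add_one hk0
    have hβr : (β : ℝ) ≤ Real.logb 2 U + 1 := clog_le_logb_add_one (by omega)
    have hkr : (1 : ℝ) ≤ k := by exact_mod_cast hk0
    have hUr : (0 : ℝ) < U := by exact_mod_cast (show 0 < U by omega)
    have hC : (0 : ℝ) < U.choose k := by exact_mod_cast Nat.choose_pos hkU
    have hUk : k * Real.logb 2 U ≤ k * Real.logb 2 k + Real.logb 2 (U.choose k) := by
      have := Real.logb_le_logb_of_le one_lt_two (by positivity)
        (by exact_mod_cast pow_le_pow_mul_choose hkU : (U : ℝ) ^ k ≤ k ^ k * U.choose k)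
      rwa [Real.logb_mul (by positivity) hC.ne', Real.logb_pow, Real.logb_pow] at this
    have hkβ : (k : ℝ) * β ≤ k * (Real.logb 2 U + 1) := by gcongr
    have hv : (L + κ + 3 : ℝ) ≤ 20 * Real.logb 2 k := by linarith
    have hkv : (1 + 3 * k + 6 * k : ℝ) * (L + κ + 3) ≤ (10 * k) * (20 * Real.logb 2 k) := by
      gcongr
      linarith
    have hk1 : (k : ℝ) ≤ k * Real.logb 2 k := le_mul_of_one_le_right (by positivity) (by linarith)
    push_cast
    linarith
  · calc lam * k ≤ 2 ^ L * 2 ^ κ := Nat.mul_le_mul hlamL hkκ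
      _ = 2 ^ (L + κ) := (pow_add _ _ _).symm
      _ < 2 ^ (L + κ + 3) := Nat.pow_lt_pow_right one_lt_two (by omega)
  · calc 6 * k < 2 ^ 3 * 2 ^ κ := by omega
      _ = 2 ^ (3 + κ) := (pow_add _ _ _).symm
      _ ≤ 2 ^ (L + κ + 3) := Nat.pow_le_pow_right two_pos (by omega)

/-- Succinct dictionaries for sets of size polynomial in the word size. -/
theorem hasSuccinctDict_medium {lam L : ℕ} (hL : L = Nat.clog 2 lam) (h : IsLargeLog L)
    {U n : ℕ} (hU : U ≤ 2 ^ lam) (hn : 2 ^ (L / 8) < n) (hnN : n ≤ 2 ^ (11 * L)) (hnU : n ≤ U) :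
    HasSuccinctDict (4 * lam) 2225 U n (17 * (444 : ℕ) / (16 * L : ℕ) * n) := by
  have h200 := h.two_hundred_le
  have hlamL : lam ≤ 2 ^ L := hL ▸ Nat.le_pow_clog one_lt_two lam
  have hlam2 := h.pow_lt_of_le hL
  have hbase := h.base_le
  have hL8 : L / 8 * 8 ≤ L := Nat.div_mul_le_self _ _
  have hLpow : 2 ^ (L / 8) * 2 ^ 8 ≤ 2 ^ L := by
    rw [← pow_add]; exact Nat.pow_le_pow_right two_pos (by omega)
  -- Fields of `16 * L` bits hold all addresses for `2 ^ (11 * L)` members, and the threshold for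
  -- crowded blocks, polynomial in `L`, lies below `2 ^ (L / 8)`. The base costs 5 probes and each
  -- of the 444 levels 5 more.
  have := HasSuccinctDict.iterate_blocks (W := 4 * lam) (t := 5) (lam := lam) (τ := 2 ^ (L / 8))
    (N := 2 ^ (11 * L)) (v := 16 * L) (j := 444) (ε := 0) (by omega) le_rfl ?_ (by omega)
    (by omega) ?_ ?_ (fun U hU k hk hkU => (hasSuccinctDict_small hL h hU hk hkU).mono (by omega) ?_)
    (fun U hU k hk _ hkU => by simpa using hasSuccinctDict_large hL h hU hk hkU) hU hn hnN hnU
  · simpa using this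
  · rw [zero_add, div_le_one (by exact_mod_cast (show 0 < 16 * L by omega))]
    have h1 : 7548 ≤ 16 * L := by omega
    have h2 : (7548 : ℝ) ≤ (16 * L : ℕ) := by exact_mod_cast h1
    norm_num at h2 ⊢
    exact h2
  · refine le_trans ?_ h.pow_le
    have h1 : 16 * L ≤ 2 ^ 7 * (L / 8 + 1) := by omega
    calc (6 * (16 * L) ^ 5) ^ 2 ≤ (2 ^ 3 * (2 ^ 7 * (L / 8 + 1)) ^ 5) ^ 2 := by gcongr; norm_num
      _ = 2 ^ 76 * (L / 8 + 1) ^ 10 := by ring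
      _ ≤ 2 ^ 200 * (L / 8 + 1) ^ 10 := Nat.mul_le_mul_right _ (by norm_num)
  · calc 2 ^ (11 * L) * lam * (444 + 6) < 2 ^ (11 * L) * 2 ^ L * 2 ^ L := by
          refine Nat.mul_lt_mul_of_le_of_lt (Nat.mul_le_mul_left _ hlamL) ?_ (by positivity)
          have : 2 ^ 9 ≤ 2 ^ L := Nat.pow_le_pow_right two_pos (by omega)
          omega
      _ = 2 ^ (13 * L) := by rw [← pow_add, ← pow_add]; congr 1; ring
      _ ≤ 2 ^ (16 * L) := Nat.pow_le_pow_right two_pos (by omega)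
  · rw [zero_mul, zero_add]
    exact_mod_cast (show 3 ≤ 16 * L by omega)

/-- Succinct dictionaries for all sets, if the word size is large. -/
theorem hasSuccinctDict_of_isLargeLog {lam L : ℕ} (hL : L = Nat.clog 2 lam) (h : IsLargeLog L)
    {U n : ℕ} (hU : U ≤ 2 ^ lam) (hnU : n ≤ U) :
    HasSuccinctDict (4 * lam) 4445 U n (3000 / L * n + 3) := by
  have h200 := h.two_hundred_le
  have hlamL : lam ≤ 2 ^ L := hL ▸ Nat.le_pow_clog one_lt_two lam
  have hlam2 := h.pow_lt_of_le hL
  have hbase := h.base_le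
  have hLpow : 2 ^ (L / 8) * 2 ^ 8 ≤ 2 ^ L := by
    rw [← pow_add]; exact Nat.pow_le_pow_right two_pos (by omega)
  have hLr : (0 : ℝ) < L := by exact_mod_cast (show 0 < L by omega)
  have hn0 : (0 : ℝ) ≤ n := Nat.cast_nonneg _
  have hε : (17 * (444 : ℕ) / (16 * L : ℕ) : ℝ) ≤ 472 / L := by
    push_cast
    rw [div_le_div_iff₀ (by positivity) hLr]
    nlinarith
  have hεpos : (0 : ℝ) ≤ 17 * (444 : ℕ) / (16 * L : ℕ) := by positivity
  rcases le_or_gt n (2 ^ (L / 8)) with hn1 | hn1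
  · exact (hasSuccinctDict_small hL h hU hn1 hnU).mono (by omega)
      (le_add_of_nonneg_left (by positivity))
  rcases le_or_gt n (2 ^ (11 * L)) with hn2 | hn2
  · refine (hasSuccinctDict_medium hL h hU hn1 hn2 hnU).mono (by omega) ?_
    have h1 : (17 * (444 : ℕ) / (16 * L : ℕ) : ℝ) ≤ 3000 / L := hε.trans (by gcongr; norm_num)
    have := mul_le_mul_of_nonneg_right h1 hn0
    linarith
  have hLlam : L ≤ lam := by
    have := Nat.lt_two_pow_self (n := L / 8)
    omega
  have hε2 : (17 * (444 : ℕ) / (3 * lam : ℕ) : ℝ) ≤ 2516 / L := by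
    have : (L : ℝ) ≤ lam := by exact_mod_cast hLlam
    push_cast
    rw [div_le_div_iff₀ (by linarith) hLr]
    nlinarith
  have hlt : 2 ^ (L / 8) < 2 ^ (11 * L) := Nat.pow_lt_pow_right one_lt_two (by omega)
  -- Fields of `3 * lam` bits suit every `n`. The threshold is now of order `lam ^ 10`, hence below
  -- `2 ^ (11 * L)`, and the blocks below it are covered by the small and medium cases.
  have := HasSuccinctDict.iterate_blocks (W := 4 * lam) (t := 2225) (lam := lam)
    (τ := 2 ^ (11 * L)) (N := 2 ^ lam) (v := 3 * lam) (j := 444)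
    (ε := 17 * (444 : ℕ) / (16 * L : ℕ)) (by omega) hεpos ?_ (by omega)
    (by omega) ?_ ?_ (fun U hU k hk hkU => ?_)
    (fun U hU k hk _ hkU => (hasSuccinctDict_large hL h hU (hlt.trans hk) hkU).mono (by omega)
      (le_add_of_nonneg_right (by positivity))) hU hn2 (hnU.trans hU) hnU
  · refine this.mono le_rfl ?_
    have h1 : (17 * (444 : ℕ) / (16 * L : ℕ) + 17 * (444 : ℕ) / (3 * lam : ℕ) : ℝ) ≤ 3000 / L :=
      (add_le_add hε hε2).trans (by rw [← add_div]; gcongr; norm_num)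
    have := mul_le_mul_of_nonneg_right h1 hn0
    linarith
  · have h1 : (17 * (444 : ℕ) / (16 * L : ℕ) : ℝ) ≤ 1 / 2 := by
      have h2 : (15096 : ℝ) ≤ 16 * L := by exact_mod_cast (show 15096 ≤ 16 * L by omega)
      push_cast
      rw [div_le_div_iff₀ (by positivity) two_pos]
      linarith
    have h2 : (17 * (444 : ℕ) / (3 * lam : ℕ) : ℝ) ≤ 1 / 2 := by
      have h2 : (15096 : ℝ) ≤ 3 * lam := by exact_mod_cast (show 15096 ≤ 3 * lam by omega)
      push_cast
      rw [div_le_div_iff₀ (by linarith) two_pos]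
      linarith
    linarith
  · calc (6 * (3 * lam) ^ 5) ^ 2 ≤ (2 ^ 3 * (2 ^ 2 * 2 ^ L) ^ 5) ^ 2 := by gcongr <;> norm_num
      _ = 2 ^ (26 + 10 * L) := by rw [← pow_add, ← pow_mul, ← pow_add, ← pow_mul]; congr 1; ring
      _ ≤ 2 ^ (11 * L) := Nat.pow_le_pow_right two_pos (by omega)
  · have h1 : 450 < 2 ^ lam :=
      lt_of_lt_of_le (by norm_num) (Nat.pow_le_pow_right two_pos (show 9 ≤ lam by omega))
    calc 2 ^ lam * lam * (444 + 6) < 2 ^ lam * 2 ^ lam * 2 ^ lam :=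
          Nat.mul_lt_mul_of_le_of_lt (Nat.mul_le_mul_left _ Nat.lt_two_pow_self.le) h1
            (by positivity)
      _ = 2 ^ (3 * lam) := by rw [← pow_add, ← pow_add]; congr 1; ring
  · have h3 : (3 : ℝ) ≤ (3 * lam : ℕ) := by exact_mod_cast (show 3 ≤ 3 * lam by omega)
    have hk0 : (0 : ℝ) ≤ k := Nat.cast_nonneg _
    rcases le_or_gt k (2 ^ (L / 8)) with hk1 | hk1
    · exact (hasSuccinctDict_small hL h hU hk1 hkU).mono (by omega)
        (by have := mul_nonneg hεpos hk0; linarith)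
    · exact (hasSuccinctDict_medium hL h hU hk1 hk hkU).mono le_rfl (by linarith)

/-! ### From bit windows to cells, and from members to all queries. -/

namespace CellProbeAlg

/-- Read `c` consecutive cells from address `a` on, and continue with their contents. -/
def readCells {w : ℕ} {α : Type} :
    ℕ → ℕ → (List (Fin w → Bool) → CellProbeAlg w α) → CellProbeAlg w α
  | 0, _, g => g []
  | c + 1, a, g => probe a fun v => readCells c (a + 1) fun l => g (v :: l)

theorem eval_readCells {w : ℕ} {α : Type} (mem : ℕ → Fin w → Bool) (c a : ℕ)
    (g : List (Fin w → Bool) → CellProbeAlg w α) :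
    (readCells c a g).eval mem = (g ((List.range' a c).map mem)).eval mem := by
  induction c generalizing a g with
  | zero => rfl
  | succ c ih => simp only [readCells, eval, ih, List.range'_succ, List.map_cons]

theorem probes_readCells {w : ℕ} {α : Type} (mem : ℕ → Fin w → Bool) (c a : ℕ)
    (g : List (Fin w → Bool) → CellProbeAlg w α) :
    (readCells c a g).probes mem = (g ((List.range' a c).map mem)).probes mem + c := by
  induction c generalizing a g with
  | zero => rfl
  | succ c ih =>
    simp only [readCells, probes, ih, List.range'_succ, List.map_cons]
    omega

end CellProbeAlg

/-- A string of `L` bits as a memory, padded with zeros. -/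
def BitMem.ofBits {L : ℕ} (bits : Fin L → Bool) : BitMem :=
  fun i => if h : i < L then bits ⟨i, h⟩ else false

theorem cellsOf_apply {w L : ℕ} (bits : Fin L → Bool) (i : ℕ) (j : Fin w) :
    cellsOf w bits i j = BitMem.ofBits bits (i * w + j) := rfl

/-- A window of at most `c * w` bits meets at most `c + 1` cells, whatever its alignment. -/
theorem Probing.exists_cellProbeAlg {W t w c L : ℕ} (hW : W ≤ c * w) {α : Type} {f : BitMem → α}
    (hf : Probing W t f) :
    ∃ alg : CellProbeAlg w α, ∀ bits : Fin L → Bool,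
      alg.eval (cellsOf w bits) = f (BitMem.ofBits bits) ∧
      alg.probes (cellsOf w bits) ≤ t * (c + 1) := by
  induction t generalizing f with
  | zero =>
    obtain ⟨a, ha⟩ := hf
    exact ⟨.answer a, fun bits => ⟨(ha _).symm, Nat.zero_le _⟩⟩
  | succ t ih =>
    obtain ⟨a, g, hg, hfg⟩ := hf
    choose alg halg using fun v => ih (hg v)
    let win : List (Fin w → Bool) → Fin W → Bool := fun l i =>
      if hw : 0 < w then (l.getD ((a + i) / w - a / w) fun _ => false) ⟨(a + i) % w, Nat.mod_lt _ hw⟩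
      else false
    refine ⟨.readCells (c + 1) (a / w) fun l => alg (win l), fun bits => ?_⟩
    have hwin : win ((List.range' (a / w) (c + 1)).map (cellsOf w bits)) =
        fun i : Fin W => BitMem.ofBits bits (a + i) := by
      funext i
      have hw : 0 < w := by
        rcases Nat.eq_zero_or_pos w with rfl | h
        · have := i.2; omega
        · exact h
      have h1 : a / w ≤ (a + i) / w := Nat.div_le_div_right (Nat.le_add_right _ _)
      have h2 : (a + i) / w ≤ a / w + c := by
        rw [← Nat.add_mul_div_right _ _ hw]
        refine Nat.div_le_div_right ?_
        have := i.2
        omega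
      have h3 : (a + i) / w - a / w < c + 1 := by
        generalize (a + i) / w = p at *
        generalize a / w = q at *
        omega
      have h4 : a / w + ((a + i) / w - a / w) = (a + i) / w := Nat.add_sub_cancel' h1
      simp only [win, dif_pos hw]
      rw [List.getD_eq_getElem _ _ (by simpa using h3)]
      simp only [List.getElem_map, List.getElem_range', one_mul, h4, cellsOf_apply,
        Nat.div_add_mod']
    rw [CellProbeAlg.eval_readCells, CellProbeAlg.probes_readCells, hwin]
    obtain ⟨h1, h2⟩ := halg (fun i : Fin W => BitMem.ofBits bits (a + i)) bits
    refine ⟨h1.trans (hfg _).symm, ?_⟩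
    rw [Nat.add_mul]
    omega

theorem finsetRank_map_valEmbedding {m : ℕ} (S : Finset (Fin m)) (x : Fin m) :
    finsetRank (S.map Fin.valEmbedding) x = (S.filter fun y => y < x).card := by
  unfold finsetRank
  rw [Finset.filter_map, Finset.card_map]
  rfl

theorem finsetRank_orderEmbOfFin {m n : ℕ} (S : Finset (Fin m)) (hS : S.card = n) (i : Fin n) :
    finsetRank (S.map Fin.valEmbedding) (S.orderEmbOfFin hS i) = i := by
  rw [finsetRank_map_valEmbedding]
  have h : S.filter (fun y => y < S.orderEmbOfFin hS i) =
      (Finset.Iio i).map (S.orderEmbOfFin hS).toEmbedding := by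
    ext y
    simp only [Finset.mem_filter, Finset.mem_map, Finset.mem_Iio]
    constructor
    · rintro ⟨hy, hlt⟩
      rw [← Finset.mem_coe, ← Finset.range_orderEmbOfFin S hS] at hy
      obtain ⟨j, rfl⟩ := hy
      exact ⟨j, (S.orderEmbOfFin hS).lt_iff_lt.1 hlt, rfl⟩
    · rintro ⟨j, hj, rfl⟩
      exact ⟨Finset.orderEmbOfFin_mem S hS j, (S.orderEmbOfFin hS).lt_iff_lt.2 hj⟩
  rw [h, Finset.card_map, Fin.card_Iio]

/-- A rank computed for a non-member is arbitrary, so it is accepted only if it is below `n` and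
selecting it returns `x`. Selection at any rank below `n` returns a member, so non-members are
rejected. -/
theorem HasDict.hasIndexableDictionary {W t m n ℓ w c : ℕ} (h : HasDict W t m n ℓ)
    (hW : W ≤ c * w) : HasIndexableDictionary n m w ℓ ((t + t) * (c + 1)) := by
  classical
  obtain ⟨rank, select, hrank, hselect, hspec⟩ := h
  have hr : ∀ x, Probing W (t + t) fun mem =>
      (if rank x mem < n ∧ select (rank x mem) mem = x then (rank x mem : ℤ) else -1) := fun x =>
    (hrank x).bind (g := fun r mem => if r < n ∧ select r mem = x then (r : ℤ) else -1) fun r =>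
      (hselect r).map fun y => if r < n ∧ y = x then (r : ℤ) else -1
  choose rankAlg hrankAlg using fun x => (hr x).exists_cellProbeAlg (L := ℓ) hW
  choose selectAlg hselectAlg using fun i =>
    ((hselect i).mono (Nat.le_add_right t t)).exists_cellProbeAlg (L := ℓ) hW
  have hsub : ∀ S : Finset (Fin m), S.map Fin.valEmbedding ⊆ Finset.range m := fun S z hz => by
    obtain ⟨x, -, rfl⟩ := Finset.mem_map.1 hz
    exact Finset.mem_range.2 x.2
  have henc : ∀ S : Finset (Fin m), ∃ e : BitMem, S.card = n → ∀ mem : BitMem,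
      (∀ i < ℓ, mem i = e i) → ∀ x ∈ S.map Fin.valEmbedding,
        rank x mem = finsetRank (S.map Fin.valEmbedding) x ∧
        select (finsetRank (S.map Fin.valEmbedding) x) mem = x := fun S => by
    by_cases hS : S.card = n
    · obtain ⟨e, he⟩ := hspec _ (hsub S) (by rwa [Finset.card_map])
      exact ⟨e, fun _ => he⟩
    · exact ⟨fun _ => false, fun h => absurd h hS⟩
  choose e he using henc
  refine ⟨fun S i => e S i, fun x => rankAlg x, fun i => selectAlg (i - 1), fun S hS => ?_⟩
  have hmem := he S hS (BitMem.ofBits fun i : Fin ℓ => e S i)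
    (fun i hi => by simp [BitMem.ofBits, hi])
  refine ⟨fun x => ⟨?_, (hrankAlg x _).2⟩, fun i => ⟨?_, (hselectAlg _ _).2⟩⟩
  · rw [(hrankAlg x _).1, rankQuery]
    by_cases hx : x ∈ S
    · obtain ⟨h1, h2⟩ := hmem x (Finset.mem_map_of_mem _ hx)
      have h3 : finsetRank (S.map Fin.valEmbedding) x < n := by
        rw [← hS, ← Finset.card_map Fin.valEmbedding]
        exact finsetRank_lt_card (Finset.mem_map_of_mem _ hx)
      rw [if_pos hx, h1, if_pos ⟨h3, h2⟩, finsetRank_map_valEmbedding]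
    · rw [if_neg hx, if_neg]
      rintro ⟨h1, h2⟩
      obtain ⟨y, hy, hyr⟩ := exists_finsetRank_eq (S := S.map Fin.valEmbedding)
        (by rwa [Finset.card_map, hS])
      have h3 := (hmem y hy).2
      rw [hyr, h2] at h3
      obtain ⟨z, hz, hzy⟩ := Finset.mem_map.1 hy
      exact hx (by rwa [← Fin.ext (hzy.trans h3.symm)])
  · rw [(hselectAlg _ _).1, Nat.add_sub_cancel]
    have := (hmem _ (Finset.mem_map_of_mem _ (Finset.orderEmbOfFin_mem S hS i))).2
    rwa [Fin.valEmbedding_apply, finsetRank_orderEmbOfFin] at this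

theorem HasIndexableDictionary.mono {n m w L s t : ℕ} (h : HasIndexableDictionary n m w L s)
    (hst : s ≤ t) : HasIndexableDictionary n m w L t := by
  obtain ⟨encode, rankAlg, selectAlg, h⟩ := h
  exact ⟨encode, rankAlg, selectAlg, fun S hS =>
    ⟨fun x => ⟨((h S hS).1 x).1, (((h S hS).1 x).2).trans hst⟩,
      fun k => ⟨((h S hS).2 k).1, (((h S hS).2 k).2).trans hst⟩⟩⟩

/-! ### Logarithmic word sizes and the final assembly. -/

theorem IsLogWordSize.exists_clog_le {w : ℕ → ℕ} (hw : IsLogWordSize w) :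
    ∃ c m₀ : ℕ, ∀ m ≥ m₀, Nat.clog 2 m ≤ c * w m := by
  obtain ⟨C, hC⟩ := hw.2.2.bound
  obtain ⟨m₀, hm⟩ := Filter.eventually_atTop.1 hC
  obtain ⟨c, hc⟩ := exists_nat_ge (2 * C)
  refine ⟨c, max m₀ 2, fun m hmm => ?_⟩
  have h1 := hm m ((le_max_left _ _).trans hmm)
  have h2 : 2 ≤ m := (le_max_right _ _).trans hmm
  rw [Real.norm_of_nonneg (logb_natCast_nonneg m), Real.norm_of_nonneg (Nat.cast_nonneg _)] at h1
  have h3 := clog_le_logb_add_one (show 0 < m by omega)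
  have h4 : 1 ≤ Real.logb 2 m := by
    rw [Real.le_logb_iff_rpow_le one_lt_two (by exact_mod_cast (show 0 < m by omega))]
    simpa using (by exact_mod_cast h2 : (2 : ℝ) ≤ m)
  have h5 : (2 * C) * (w m : ℝ) ≤ c * w m := mul_le_mul_of_nonneg_right hc (Nat.cast_nonneg _)
  have h6 : (Nat.clog 2 m : ℝ) ≤ c * w m := by linarith
  exact_mod_cast h6

theorem isLogWordSize_clog : IsLogWordSize (Nat.clog 2) := by
  refine ⟨fun m hm => Nat.clog_pos one_lt_two (by omega), ?_, ?_⟩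
  · refine Asymptotics.IsBigO.of_bound 2 (Filter.eventually_atTop.2 ⟨2, fun m hm => ?_⟩)
    rw [Real.norm_of_nonneg (logb_natCast_nonneg m), Real.norm_of_nonneg (Nat.cast_nonneg _)]
    have h3 := clog_le_logb_add_one (show 0 < m by omega)
    have h4 : 1 ≤ Real.logb 2 m := by
      rw [Real.le_logb_iff_rpow_le one_lt_two (by exact_mod_cast (show 0 < m by omega))]
      simpa using (by exact_mod_cast hm : (2 : ℝ) ≤ m)
    linarith
  · refine Asymptotics.IsBigO.of_bound 1 (Filter.Eventually.of_forall fun m => ?_)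
    rw [Real.norm_of_nonneg (logb_natCast_nonneg m), Real.norm_of_nonneg (Nat.cast_nonneg _), one_mul]
    exact logb_le_clog m

theorem clog_choose_le (m n : ℕ) : Nat.clog 2 (m.choose n) ≤ n * Nat.clog 2 m := by
  refine Nat.clog_le_of_le_pow ((Nat.choose_le_pow m n).trans ?_)
  rw [Nat.mul_comm, pow_mul]
  exact Nat.pow_le_pow_left (Nat.le_pow_clog one_lt_two m) n

/-- If the universe is bounded, constantly many probes read the whole index of the set. -/
theorem hasIndexableDictionary_of_lt {w : ℕ → ℕ} (hw : ∀ m, 2 ≤ m → 0 < w m) {m₀ m n : ℕ}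
    (hm : m < m₀) (hnm : n ≤ m) {L : ℕ} (hL : lowerBoundBits n m ≤ L) :
    HasIndexableDictionary n m (w m) L ((2 + 2) * (m₀ + 1)) := by
  refine HasDict.hasIndexableDictionary ((HasDict.of_index le_rfl).mono le_rfl hL) ?_
  rcases lt_or_ge m 2 with h | h
  -- Here the word size may be 0, but there is only one set and nothing to read.
  · have : m.choose n = 1 := by
      interval_cases m <;> interval_cases n <;> rfl
    rw [this]
    simp
  · calc Nat.clog 2 (m.choose n) ≤ m := Nat.clog_le_of_le_pow (Nat.choose_le_two_pow _ _)
      _ ≤ m₀ * w m := by nlinarith [hw m h]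

/-- Indexable dictionaries for large universes. -/
theorem exists_hasIndexableDictionary {w : ℕ → ℕ} (hw : IsLogWordSize w) :
    ∃ t m₀ : ℕ, ∀ m ≥ m₀, 1 ≤ Nat.clog 2 (Nat.clog 2 m) ∧ ∀ n ≤ m, ∃ ℓ : ℕ,
      (ℓ : ℝ) ≤ Real.logb 2 (m.choose n) + (3000 / Nat.clog 2 (Nat.clog 2 m) * n + 3) ∧
      ∀ L ≥ ℓ, HasIndexableDictionary n m (w m) L t := by
  obtain ⟨c, m₁, hc⟩ := hw.exists_clog_le
  obtain ⟨L₀, hL⟩ := exists_isLargeLog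
  refine ⟨(4445 + 4445) * (4 * c + 1), max m₁ (2 ^ 2 ^ (L₀ + 1)), fun m hm => ?_⟩
  have h1 := hc m ((le_max_left _ _).trans hm)
  have h2 : L₀ + 1 ≤ Nat.clog 2 (Nat.clog 2 m) := by
    rw [← Nat.clog_pow 2 (L₀ + 1) one_lt_two]
    refine Nat.clog_mono_right _ ?_
    rw [← Nat.clog_pow 2 (2 ^ (L₀ + 1)) one_lt_two]
    exact Nat.clog_mono_right _ ((le_max_right _ _).trans hm)
  refine ⟨by omega, fun n hn => ?_⟩
  obtain ⟨ℓ, h3, h4⟩ := hasSuccinctDict_of_isLargeLog rfl (hL _ (by omega : L₀ ≤ _))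
    (Nat.le_pow_clog one_lt_two m) hn
  exact ⟨ℓ, h3, fun L hL => (h4.mono le_rfl hL).hasIndexableDictionary (by
    rw [Nat.mul_assoc]; exact Nat.mul_le_mul_left _ h1)⟩

/-- The redundancy as a function of the number of members. -/
noncomputable def redundancy (n : ℕ) : ℝ :=
  3000 / max 1 (Real.logb 2 (Real.logb 2 n)) * n + 3

theorem isLittleO_redundancy :
    Asymptotics.IsLittleO Filter.atTop redundancy (fun n : ℕ => (n : ℝ)) := by
  have hlog : Filter.Tendsto (Real.logb 2) Filter.atTop Filter.atTop :=
    Real.tendsto_logb_atTop one_lt_two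
  have hcast : Filter.Tendsto (fun n : ℕ => (n : ℝ)) Filter.atTop Filter.atTop :=
    tendsto_natCast_atTop_atTop
  have h1 : Filter.Tendsto (fun n : ℕ => max 1 (Real.logb 2 (Real.logb 2 (n : ℝ)))) Filter.atTop
      Filter.atTop :=
    Filter.tendsto_atTop_mono (fun n => le_max_right _ _) (hlog.comp (hlog.comp hcast))
  refine Asymptotics.IsLittleO.add ?_ ?_
  · have h2 : Asymptotics.IsLittleO Filter.atTop
        (fun n : ℕ => 3000 / max 1 (Real.logb 2 (Real.logb 2 (n : ℝ)))) (fun _ => (1 : ℝ)) :=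
      (Asymptotics.isLittleO_one_iff ℝ).2 (h1.const_div_atTop 3000)
    simpa using h2.mul_isBigO (Asymptotics.isBigO_refl (fun n : ℕ => (n : ℝ)) Filter.atTop)
  · exact Asymptotics.isLittleO_const_left.2 (Or.inr (tendsto_norm_atTop_atTop.comp hcast))

theorem redundancy_nonneg (n : ℕ) : 0 ≤ redundancy n := by
  have : (0 : ℝ) < max 1 (Real.logb 2 (Real.logb 2 n)) := lt_max_of_lt_left one_pos
  unfold redundancy
  positivity

/-- This removes `m` from the redundancy: since `n ≤ m`, the iterated logarithm of `n` is at most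
that of `m`. The maximum with 1 guards against small `n`. -/
theorem le_redundancy {m n : ℕ} (hnm : n ≤ m) (hm : 1 ≤ Nat.clog 2 (Nat.clog 2 m)) :
    3000 / Nat.clog 2 (Nat.clog 2 m) * n + 3 ≤ redundancy n := by
  have h : max 1 (Real.logb 2 (Real.logb 2 n)) ≤ Nat.clog 2 (Nat.clog 2 m) := by
    refine max_le (by exact_mod_cast hm) ?_
    refine le_trans ?_ (logb_le_clog _)
    rcases lt_or_ge n 2 with h | h
    · have : Real.logb 2 (n : ℝ) = 0 := by interval_cases n <;> simp
      rw [this, Real.logb_zero]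
      exact logb_natCast_nonneg _
    · have h1 : 0 < Real.logb 2 (n : ℝ) := Real.logb_pos one_lt_two (by exact_mod_cast h)
      refine Real.logb_le_logb_of_le one_lt_two h1 ((logb_le_clog n).trans ?_)
      exact_mod_cast Nat.clog_mono_right 2 hnm
  have h0 : (0 : ℝ) < max 1 (Real.logb 2 (Real.logb 2 n)) := lt_max_of_lt_left one_pos
  unfold redundancy
  gcongr

theorem exists_indexableDictionary_lowerBound {w : ℕ → ℕ} (hw : IsLogWordSize w) :
    ∃ t : ℕ, ∀ m n : ℕ, n ≤ m → ∃ L : ℕ, (L : ℝ) ≤ (lowerBoundBits n m : ℝ) + redundancy n ∧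
      HasIndexableDictionary n m (w m) L t := by
  obtain ⟨t, m₀, h⟩ := exists_hasIndexableDictionary hw
  refine ⟨max t ((2 + 2) * (m₀ + 1)), fun m n hnm => ?_⟩
  rcases lt_or_ge m m₀ with hm | hm
  · exact ⟨lowerBoundBits n m, le_add_of_nonneg_right (redundancy_nonneg n),
      (hasIndexableDictionary_of_lt hw.1 hm hnm le_rfl).mono (le_max_right _ _)⟩
  · obtain ⟨h1, h2⟩ := h m hm
    obtain ⟨ℓ, h3, h4⟩ := h2 n hnm
    refine ⟨ℓ, ?_, (h4 ℓ le_rfl).mono (le_max_left _ _)⟩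
    have := le_redundancy hnm h1
    have := logb_le_clog (m.choose n)
    unfold lowerBoundBits
    linarith

theorem exists_indexableDictionary_words {w : ℕ → ℕ} (hw : IsLogWordSize w) :
    ∃ t : ℕ, ∀ m n : ℕ, n ≤ m →
      HasIndexableDictionary n m (w m) (n * Nat.clog 2 m) t := by
  obtain ⟨t, m₀, h⟩ := exists_hasIndexableDictionary hw
  obtain ⟨c, m₁, hc⟩ := hw.exists_clog_le
  -- Per member, `lg n` must cover 3000 bits of redundancy, 3 for the additive constant and 2
  -- bounding `lg 3`.
  obtain ⟨n₀, hn₀⟩ := Filter.eventually_atTop.1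
    ((Real.tendsto_logb_atTop one_lt_two).comp
      (tendsto_natCast_atTop_atTop (R := ℝ))|>.eventually_ge_atTop 3005)
  refine ⟨max t (max ((2 + 2) * (max m₀ m₁ + 1)) ((2 + 2) * ((n₀ + 1) * c + 1))),
    fun m n hnm => ?_⟩
  rcases lt_or_ge m (max m₀ m₁) with hm | hm
  · exact (hasIndexableDictionary_of_lt hw.1 hm hnm (clog_choose_le m n)).mono
      ((le_max_left _ _).trans (le_max_right _ _))
  have hm₁ := hc m ((le_max_right _ _).trans hm)
  rcases le_or_gt n n₀ with hn | hn
  · refine (HasDict.hasIndexableDictionary (c := (n₀ + 1) * c)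
      ((HasDict.of_index le_rfl).mono le_rfl (clog_choose_le m n)) ?_).mono
      ((le_max_right _ _).trans (le_max_right _ _))
    calc Nat.clog 2 (m.choose n) ≤ n * Nat.clog 2 m := clog_choose_le m n
      _ ≤ (n₀ + 1) * (c * w m) := Nat.mul_le_mul (by omega) hm₁
      _ = _ := by ring
  · obtain ⟨h1, h2⟩ := h m ((le_max_left _ _).trans hm)
    obtain ⟨ℓ, h3, h4⟩ := h2 n hnm
    refine (h4 _ ?_).mono (le_max_left _ _)
    have hn0 : 0 < n := by omega
    have hnr : (1 : ℝ) ≤ n := by exact_mod_cast hn0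
    have hmr : (0 : ℝ) < m := by exact_mod_cast (show 0 < m by omega)
    have hlogn : 3005 ≤ Real.logb 2 (n : ℝ) := hn₀ n hn.le
    have h5 : Real.logb 2 (m.choose n) ≤ n * (Real.logb 2 3 + Real.logb 2 m - Real.logb 2 n) := by
      have := Real.logb_le_logb_of_le one_lt_two (by exact_mod_cast Nat.choose_pos hnm)
        (choose_le_three_mul_div_pow (u := m) hn0)
      rwa [Real.logb_pow, Real.logb_div (by positivity) (by positivity),
        Real.logb_mul (by norm_num) hmr.ne'] at this
    have h6 : Real.logb 2 3 ≤ 2 := by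
      rw [Real.logb_le_iff_le_rpow one_lt_two (by norm_num)]
      norm_num
    have h7 : (3000 / Nat.clog 2 (Nat.clog 2 m) : ℝ) * n ≤ 3000 * n := by
      gcongr
      exact div_le_self (by norm_num) (by exact_mod_cast h1)
    have h8 := logb_le_clog m
    have h9 : (n : ℝ) * (Real.logb 2 3 + Real.logb 2 m - Real.logb 2 n) ≤
        n * (Nat.clog 2 m - 3003) :=
      mul_le_mul_of_nonneg_left (by linarith) (Nat.cast_nonneg _)
    have h10 : (ℓ : ℝ) ≤ n * Nat.clog 2 m := by linarith
    exact_mod_cast h10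

theorem mainTheorem2 :
    (∀ w : ℕ → ℕ, IsLogWordSize w →
      ∃ (t : ℕ) (e : ℕ → ℝ),
        Asymptotics.IsLittleO Filter.atTop e (fun n : ℕ => (n : ℝ)) ∧
        ∀ m n : ℕ, n ≤ m →
          ∃ L : ℕ, (L : ℝ) ≤ (lowerBoundBits n m : ℝ) + e n ∧
            HasIndexableDictionary n m (w m) L t) ∧
    (∀ w : ℕ → ℕ, IsLogWordSize w →
      ∃ t : ℕ, ∀ m n : ℕ, n ≤ m →
        HasIndexableDictionary n m (w m) (n * Nat.clog 2 m) t) ∧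
    (∃ t : ℕ, ∀ m n : ℕ, n ≤ m →
      HasIndexableDictionary n m (Nat.clog 2 m) (n * Nat.clog 2 m) t) := by
  refine ⟨fun w hw => ?_, fun w hw => exists_indexableDictionary_words hw,
    exists_indexableDictionary_words isLogWordSize_clog⟩
  obtain ⟨t, ht⟩ := exists_indexableDictionary_lowerBound hw
  exact ⟨t, redundancy, isLittleO_redundancy, ht⟩
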